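/- Consider the linear time-invariant system $x_{k+1}=Ax_k+Bu_k+w_k$, $y_k=Cx_k+v_k$ with $x_k\in\mathbb R^n$, $u_k\in\mathbb R^p$, $y_k\in\mathbb R^m$, independent i.i.d. noises $w_k\sim\mathcal N(0,Q)$ and $v_k\sim\mathcal N(0,R)$, and an independent initial state $x_0\sim\mathcal N(\hat x_{0|-1},P)$. The defender runs the steady-state Kalman filter $$\hat x_{k|k}=(I-KC)\hat x_{k|k-1}+Ky_k,\qquad \hat x_{k+1|k}=A\hat x_{k|k}+Bu_k,$$ where $P\succeq 0$ satisfies $P=APA^T+Q-AKCPA^T$ with $K=PC^T\mathcal P^{-1}$ and $\mathcal P=CPC^T+R\succ 0$, and uses state feedback with physical watermarking, $u_k=L\hat x_{k|k}+\Delta u_k$. The watermarks $\Delta u_0,\Delta u_1,\dots$ are i.i.d. $\mathcal N(0,\mathcal Q)$ and predetermined, so that all output laws below are taken for a fixed realization of $(\Delta u_k)_{k\ge 0}$. Under a replay attack starting at time $0$, the delivered output $y_k$ is replaced, for every $k\ge 0$, by an output $y_{k-N}$ recorded earlier, with a delay $N$ so large that the record is independent of the current initial state, noises and watermarks. The record comes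 from the attack-free closed loop (with its own noises and its own i.i.d. $\mathcal N(0,\mathcal Q)$ watermarks), which at time $-N$ is in steady state: the law of $(x_{-N},\hat x_{-N|-N-1})$ is Gaussian and invariant under the closed loop, and the estimation error $x_{-N}-\hat x_{-N|-N-1}$ is $\mathcal N(0,P)$ and independent of $\hat x_{-N|-N-1}$. The information flow of the attack is $$IF_T=\frac1{T+1}\,D_{KL}\big(\text{law of the delivered } y_{0:T}\text{ under attack}\,\big\|\,\text{law of } y_{0:T}\text{ without attack}\big).$$ Let $\mathcal A=(A+BL)(I-KC)$ and assume $\rho(\mathcal A)<1$. Then the Lyapunov equation $\Sigma=\mathcal A\Sigma\mathcal A^T+B\mathcal QB^T$ has a unique solution $\Sigma$, and almost surely (with respect to the watermark sequence) $\lim_{T\to\infty}IF_T$ exists, is finite and satisfies $$\lim_{T\to\infty}IF_T\ \ge\ \epsilon:=\frac{\operatorname{tr}\left(\mathcal P^{-1}C\Sigma C^T\right)}{2}.$$ Consequently, almost surely, for every $\epsilon'<\epsilon$ the watermarked policy generates for all sufficiently large $T$ an $\epsilon'$-strong information flow conditional on the replay attack, i.e. $IF_T\ge\epsilon'$. -/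

import Mathlib

open Filter Topology MeasureTheory ProbabilityTheory InformationTheory
open scoped ENNReal Matrix

namespace ReplayAttack

/-- The multivariate normal law `𝒩(μ, S)` on `ℝᵈ`, with `ℝᵈ` written as `Fin d → ℝ`. -/
noncomputable def gaussianVec {d : ℕ} (μ : Fin d → ℝ) (S : Matrix (Fin d) (Fin d) ℝ) :
    Measure (Fin d → ℝ) :=
  (multivariateGaussian (WithLp.toLp 2 μ) S).map WithLp.ofLp

/-- The system model `ℳ`: the dynamics `x⁺ = A x + B u + w`, `y = C x + v`, with `w ∼ 𝒩(0, Q)` and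
`v ∼ 𝒩(0, R)`, and the prior `x₀ ∼ 𝒩(x̂₀, P)` of the defender. -/
structure Model (n p m : ℕ) where
  A : Matrix (Fin n) (Fin n) ℝ
  B : Matrix (Fin n) (Fin p) ℝ
  C : Matrix (Fin m) (Fin n) ℝ
  Q : Matrix (Fin n) (Fin n) ℝ
  R : Matrix (Fin m) (Fin m) ℝ
  xhat0 : Fin n → ℝ
  P : Matrix (Fin n) (Fin n) ℝ
  Q_psd : Q.PosSemidef
  R_psd : R.PosSemidef
  P_psd : P.PosSemidef

variable {n p m : ℕ}

namespace Model

/-- The innovation covariance `𝒫 = C P Cᵀ + R`. -/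
def innovCov (M : Model n p m) : Matrix (Fin m) (Fin m) ℝ :=
  M.C * M.P * M.Cᵀ + M.R

/-- The Kalman gain `K = P Cᵀ (C P Cᵀ + R)⁻¹`. -/
noncomputable def gain (M : Model n p m) : Matrix (Fin n) (Fin m) ℝ :=
  M.P * M.Cᵀ * M.innovCov⁻¹

/-- The Kalman filter is in steady state: the a priori error covariance `P` is a fixed point of
the Riccati recursion. -/
def FilterSteady (M : Model n p m) : Prop :=
  M.P = M.A * M.P * M.Aᵀ + M.Q - M.A * M.gain * M.C * M.P * M.Aᵀ

/-- The matrix `𝒜 = (A + B L) (I - K C)`. -/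
noncomputable def loopMatrix (M : Model n p m) (L : Matrix (Fin p) (Fin n) ℝ) :
    Matrix (Fin n) (Fin n) ℝ :=
  (M.A + M.B * L) * (1 - M.gain * M.C)

/-- One step of the closed loop. The state is the pair `(x, x̂)` of the plant state `x_k` and the
a priori estimate `x̂_{k|k-1}`; `y` is the output delivered to the defender, `δ` the watermark and
`w` the process noise. The defender computes `x̂_{k|k} = (I - K C) x̂_{k|k-1} + K y` and applies
`u = L x̂_{k|k} + δ`. -/
noncomputable def step (M : Model n p m) (L : Matrix (Fin p) (Fin n) ℝ)
    (s : (Fin n → ℝ) × (Fin n → ℝ)) (y : Fin m → ℝ) (δ : Fin p → ℝ) (w : Fin n → ℝ) :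
    (Fin n → ℝ) × (Fin n → ℝ) :=
  let xpost := (1 - M.gain * M.C) *ᵥ s.2 + M.gain *ᵥ y
  let u := L *ᵥ xpost + δ
  (M.A *ᵥ s.1 + M.B *ᵥ u + w, M.A *ᵥ xpost + M.B *ᵥ u)

/-- The output delivered to the defender at time `k` when the plant state is `x`: the genuine
reading `C x + v` plus the bias `d`, which the attacker chooses knowing the genuine reading. -/
def reading (M : Model n p m) (d : (Fin m → ℝ) → Fin m → ℝ)
    (x : Fin n → ℝ) (v : Fin m → ℝ) : Fin m → ℝ :=
  (M.C *ᵥ x + v) + d (M.C *ᵥ x + v)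

/-- The trajectory `k ↦ (x_k, x̂_{k|k-1})` of the closed loop for given initial state, watermark,
noises and sensor attack. -/
noncomputable def trajectory (M : Model n p m) (L : Matrix (Fin p) (Fin n) ℝ)
    (δ : ℕ → Fin p → ℝ) (d : ℕ → (Fin m → ℝ) → Fin m → ℝ)
    (s : (Fin n → ℝ) × (Fin n → ℝ)) (w : ℕ → Fin n → ℝ) (v : ℕ → Fin m → ℝ) :
    ℕ → (Fin n → ℝ) × (Fin n → ℝ)
  | 0 => s
  | k + 1 =>
    let t := M.trajectory L δ d s w v k
    M.step L t (M.reading (d k) t.1 (v k)) (δ k) (w k)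

/-- The output `y_k` delivered to the defender along the trajectory. -/
noncomputable def output (M : Model n p m) (L : Matrix (Fin p) (Fin n) ℝ)
    (δ : ℕ → Fin p → ℝ) (d : ℕ → (Fin m → ℝ) → Fin m → ℝ)
    (s : (Fin n → ℝ) × (Fin n → ℝ)) (w : ℕ → Fin n → ℝ) (v : ℕ → Fin m → ℝ) (k : ℕ) :
    Fin m → ℝ :=
  M.reading (d k) (M.trajectory L δ d s w v k).1 (v k)

/-- The joint law of the process noise and the measurement noise: two independent sequences of
independent `𝒩(0, Q)` and `𝒩(0, R)` vectors. -/
noncomputable def noiseLaw (M : Model n p m) : Measure ((ℕ → Fin n → ℝ) × (ℕ → Fin m → ℝ)) :=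
  (Measure.infinitePi fun _ : ℕ => gaussianVec 0 M.Q).prod
    (Measure.infinitePi fun _ : ℕ => gaussianVec 0 M.R)

/-- `π`, a law of the pair `(x_k, x̂_{k|k-1})`, is a steady state of the attack-free closed loop
with watermark covariance `W`: it is Gaussian, given the estimate the state is
`𝒩(x̂_{k|k-1}, P)`-distributed (the error is `𝒩(0, P)` and independent of the estimate), and `π`
is preserved by a step of the loop with fresh noises and a fresh watermark. -/
structure IsSteadyState (M : Model n p m) (L : Matrix (Fin p) (Fin n) ℝ)
    (W : Matrix (Fin p) (Fin p) ℝ) (π : Measure ((Fin n → ℝ) × (Fin n → ℝ))) : Prop where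
  gaussian : IsGaussian π
  error_law : π.map (fun s => s.1 - s.2) = gaussianVec 0 M.P
  error_indep : IndepFun (fun s => s.1 - s.2) (fun s => s.2) π
  invariant :
    (π.prod ((gaussianVec 0 M.Q).prod ((gaussianVec 0 M.R).prod (gaussianVec 0 W)))).map
      (fun ω => M.step L ω.1 (M.C *ᵥ ω.1.1 + ω.2.2.1) ω.2.2.2 ω.2.1) = π

/-- The law of the record of outputs that the adversary has observed, `r_k = y_{k-N}` for `k ≥ 0`:
the outputs of the attack-free closed loop, started at time `-N` in the steady state `π`, with its
own noises and its own watermarks, which are independent `𝒩(0, W)` vectors. -/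
noncomputable def recordLaw (M : Model n p m) (L : Matrix (Fin p) (Fin n) ℝ)
    (W : Matrix (Fin p) (Fin p) ℝ) (π : Measure ((Fin n → ℝ) × (Fin n → ℝ))) :
    Measure (ℕ → Fin m → ℝ) :=
  ((π.prod M.noiseLaw).prod (Measure.infinitePi fun _ : ℕ => gaussianVec 0 W)).map
    (fun ω k => M.output L ω.2 0 ω.1.1 ω.1.2.1 ω.1.2.2 k)

end Model

/-- A (sensor) attack strategy: the bias `d_k` injected at time `k`, as a function of the record
held by the adversary and of the genuine current reading. -/
abbrev AttackStrategy (m : ℕ) : Type :=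
  (ℕ → Fin m → ℝ) → ℕ → (Fin m → ℝ) → Fin m → ℝ

/-- The replay attack `d_k = y_{k-N} - (C x_k + v_k)`: the delivered output is the recorded one. -/
def replayAttack (m : ℕ) : AttackStrategy m :=
  fun r k y => r k - y

namespace Model

/-- The law of the outputs `y_{0:T}` delivered to the defender under the attack strategy `a`, when
the defender uses `u_k = L x̂_{k|k} + δ_k` with the predetermined watermark sequence `δ`. The initial
state is `𝒩(x̂₀, P)`-distributed, the filter starts from `x̂₀`, and the record of the adversary is
independent of the current initial state and noises. -/
noncomputable def outputLaw (M : Model n p m) (L : Matrix (Fin p) (Fin n) ℝ)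
    (W : Matrix (Fin p) (Fin p) ℝ) (π : Measure ((Fin n → ℝ) × (Fin n → ℝ)))
    (δ : ℕ → Fin p → ℝ) (a : AttackStrategy m) (T : ℕ) : Measure (Fin (T + 1) → Fin m → ℝ) :=
  ((M.recordLaw L W π).prod ((gaussianVec M.xhat0 M.P).prod M.noiseLaw)).map
    (fun ω k => M.output L δ (a ω.1) (ω.2.1, M.xhat0) ω.2.2.1 ω.2.2.2 k)

/-- The information flow `IF_T`: `1 / (T + 1)` times the Kullback-Leibler divergence of the output
law under attack from the output law without attack. -/
noncomputable def infoFlow (M : Model n p m) (L : Matrix (Fin p) (Fin n) ℝ)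
    (W : Matrix (Fin p) (Fin p) ℝ) (π : Measure ((Fin n → ℝ) × (Fin n → ℝ)))
    (δ : ℕ → Fin p → ℝ) (a : AttackStrategy m) (T : ℕ) : ℝ≥0∞ :=
  klDiv (M.outputLaw L W π δ a T) (M.outputLaw L W π δ 0 T) / ((T : ℝ≥0∞) + 1)

/-- The policy `u_k = L x̂_{k|k} + δ_k` generates a `U`-conditional `ε`-strong information flow over
the horizon `T`: every attack strategy in `U` has `IF_T ≥ ε`. -/
def StrongInfoFlow (M : Model n p m) (L : Matrix (Fin p) (Fin n) ℝ)
    (W : Matrix (Fin p) (Fin p) ℝ) (π : Measure ((Fin n → ℝ) × (Fin n → ℝ)))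
    (δ : ℕ → Fin p → ℝ) (U : Set (AttackStrategy m)) (ε : ℝ) (T : ℕ) : Prop :=
  ∀ a ∈ U, ENNReal.ofReal ε ≤ M.infoFlow L W π δ a T

end Model

end ReplayAttack

/-! Run the defender's filter from `M.xhat0` with the current watermark on any output record and
normalize its innovations `y_k - C x̂_{k|k-1}` by a symmetric `H` with `H 𝒫 H = 1`. This map is
causal and invertible, so it preserves the Kullback-Leibler divergence
(`klDiv_map_of_measurableEmbedding`, `injective_innovation`). Without attack the normalized
innovations are standard Gaussian; this is where the Riccati equation enters
(`exists_innovation_functional`).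

Under replay, the delivered outputs also drive the filter of the recorded loop. Two filters fed with
the same outputs differ by a trajectory of `x⁺ = 𝒜 x + B u`, with the difference of the watermarks
as input (`estimate_sub`). Hence the innovations of the defender are the recorded innovations, which
are white, plus `C` times that trajectory. The recorded initial estimate and watermarks are
independent of the recorded innovations and contribute a covariance `G_T` (`responseCov`). The
current watermark is fixed and contributes a mean `-m_T`, where `m_T` is the normalized response to
it from `x̂₀ - c`, with `c` the mean of the recorded estimate. The attacked law is therefore
`𝒩(-m_T, 1 + G_T)`, and its divergence from the standard Gaussian is `(tr G_T - log det (1 + G_T) +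
‖m_T‖²) / 2` (`klDiv_outputLaw_replayAttack`).

Divide by the number of outputs and write `τ = tr(𝒫⁻¹ C Σ Cᵀ)`. The trace tends to `τ` because the
state covariance converges to `Σ`. The squared mean tends to `τ` for almost every watermark by a law
of large numbers (`ae_tendsto_average_quadratic`). The log-determinant has a limit `φ`, because up
to an additive constant it is subadditive in time (`exists_tendsto_logDet`), and `φ ≤ τ` because
`log det (1 + G) ≤ tr G`. So the information flow converges to `(2τ - φ) / 2 ≥ τ / 2`. -/

namespace ReplayAttack

/-! ### Determinant and trace inequalities for positive semidefinite matrices. -/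

section Matrices

open Matrix

theorem conj_posSemidef {ι κ : Type*} [Fintype ι] [Fintype κ] {X : Matrix ι ι ℝ}
    (hX : X.PosSemidef) (N : Matrix κ ι ℝ) :
    (N * X * Nᵀ).PosSemidef := by
  simpa using hX.mul_mul_conjTranspose_same N

variable {ι κ : Type*} [Fintype ι] [DecidableEq ι] [Fintype κ] [DecidableEq κ]

theorem one_le_eigenvalues {Y : Matrix ι ι ℝ} (hY : Y.IsHermitian) (h : (Y - 1).PosSemidef)
    (i : ι) : 1 ≤ hY.eigenvalues i := by
  have h1 := h.dotProduct_mulVec_nonneg (hY.eigenvectorBasis i).ofLp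
  have h2 := hY.mulVec_eigenvectorBasis i
  have h3 : (hY.eigenvectorBasis i).ofLp ⬝ᵥ (hY.eigenvectorBasis i).ofLp = 1 := by
    have := hY.eigenvectorBasis.orthonormal.1 i
    have h4 : inner ℝ (hY.eigenvectorBasis i) (hY.eigenvectorBasis i) = (1 : ℝ) := by
      rw [real_inner_self_eq_norm_sq, this]; norm_num
    rw [EuclideanSpace.inner_eq_star_dotProduct] at h4
    simpa using h4
  rw [sub_mulVec, h2, dotProduct_sub] at h1
  simp only [star_trivial, one_mulVec, dotProduct_smul, h3] at h1
  simpa using h1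

theorem one_le_det_one_add {X : Matrix ι ι ℝ} (hX : X.PosSemidef) : 1 ≤ (1 + X).det := by
  have hY : (1 + X).IsHermitian := isHermitian_one.add hX.isHermitian
  rw [hY.det_eq_prod_eigenvalues]
  refine Finset.one_le_prod fun i _ => ?_
  simpa using one_le_eigenvalues hY (by simpa using hX) i

/-- `1 + x ≤ exp x` at each eigenvalue of `X`. Taken in logarithms, this is the bound that yields `φ
≤ τ` in the final limit. -/
theorem det_one_add_le_exp_trace {X : Matrix ι ι ℝ} (hX : X.PosSemidef) :
    (1 + X).det ≤ Real.exp X.trace := by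
  have hY : (1 + X).IsHermitian := isHermitian_one.add hX.isHermitian
  have h1 := one_le_eigenvalues hY (by simpa using hX)
  have htr : X.trace = ∑ i, (hY.eigenvalues i - 1) := by
    have := hY.trace_eq_sum_eigenvalues
    simp only [trace_add, trace_one, RCLike.ofReal_real_eq_id, id_eq] at this
    rw [Finset.sum_sub_distrib, ← this]; simp
  rw [hY.det_eq_prod_eigenvalues, htr, Real.exp_sum]
  refine Finset.prod_le_prod (fun i _ => ?_) fun i _ => ?_
  · simpa using zero_le_one.trans (h1 i)
  · simpa using Real.add_one_le_exp (hY.eigenvalues i - 1)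

open scoped MatrixOrder in
theorem exists_sqrt {M : Matrix ι ι ℝ} (hM : M.PosSemidef) :
    ∃ R : Matrix ι ι ℝ, Rᵀ = R ∧ R * R = M := by
  refine ⟨CFC.sqrt M, ?_, CFC.sqrt_mul_sqrt_self _ hM.nonneg⟩
  have : IsSelfAdjoint (CFC.sqrt M) := (CFC.sqrt_nonneg M).isSelfAdjoint
  have h2 : (CFC.sqrt M)ᴴ = CFC.sqrt M := this
  rwa [conjTranspose_eq_transpose_of_trivial] at h2

/-- A positive definite matrix has a symmetric inverse square root. -/
theorem exists_inv_sqrt {M : Matrix ι ι ℝ} (hM : M.PosDef) :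
    ∃ H : Matrix ι ι ℝ, Hᵀ = H ∧ H * M * H = 1 := by
  obtain ⟨R, hRT, hRR⟩ := exists_sqrt hM.posSemidef
  have hdet : IsUnit R.det := by
    have : R.det * R.det = M.det := by rw [← det_mul, hRR]
    refine isUnit_iff_ne_zero.2 fun h => hM.det_pos.ne' ?_
    rw [← this, h, zero_mul]
  refine ⟨R⁻¹, by rw [transpose_nonsing_inv, hRT], ?_⟩
  rw [← hRR, ← mul_assoc, nonsing_inv_mul _ hdet, one_mul, mul_nonsing_inv _ hdet]

/-- Congruence by an inverse square root of `M` reduces the claim to `1 ≤ det (1 + X)`. -/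
theorem det_le_det_add {M E : Matrix ι ι ℝ} (hM : M.PosDef) (hE : E.PosSemidef) :
    M.det ≤ (M + E).det := by
  obtain ⟨H, hHT, hH⟩ := exists_inv_sqrt hM
  have h1 : 1 + H * E * Hᵀ = H * (M + E) * H := by rw [mul_add, add_mul, hH, hHT]
  have h2 := one_le_det_one_add (conj_posSemidef hE H)
  have h3 := congrArg det hH
  rw [h1] at h2
  simp only [det_mul, det_one] at h2 h3
  nlinarith [sq_nonneg H.det, hM.det_pos, mul_pos hM.det_pos hM.det_pos,
    show 0 < H.det * H.det by nlinarith [hM.det_pos]]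

theorem trace_mul_le {E X : Matrix ι ι ℝ} (hE : E.PosSemidef) (hX : (1 - X).PosSemidef) :
    (X * E).trace ≤ E.trace := by
  have : 0 ≤ ((1 - X) * E).trace := by
    obtain ⟨F, hFT, rfl⟩ := exists_sqrt hE
    rw [← mul_assoc, trace_mul_comm, ← mul_assoc]
    nth_rw 2 [← hFT]
    exact (conj_posSemidef hX F).trace_nonneg
  rw [sub_mul, one_mul, trace_sub] at this
  linarith

/-- Whiten `1 + Y` by `H`. Since `1 - H * H = H * Y * H` is positive semidefinite, `H * H ≤ 1`, and
whitening does not increase the trace of `E`. -/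
theorem det_add_le {Y E : Matrix ι ι ℝ} (hY : Y.PosSemidef) (hE : E.PosSemidef) :
    (1 + Y + E).det ≤ (1 + Y).det * Real.exp E.trace := by
  have hM : (1 + Y).PosDef := PosDef.one.add_posSemidef hY
  obtain ⟨H, hHT, hH⟩ := exists_inv_sqrt hM
  have h1 : 1 + H * E * Hᵀ = H * (1 + Y + E) * H := by rw [mul_add, add_mul, hH, hHT]
  have h2 := det_one_add_le_exp_trace (conj_posSemidef hE H)
  have h3 := congrArg det hH
  have h4 : (H * E * Hᵀ).trace ≤ E.trace := by
    rw [trace_mul_comm, ← mul_assoc, hHT]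
    refine trace_mul_le hE ?_
    have : 1 - H * H = H * Y * Hᵀ := by
      rw [← hH, hHT, mul_add, add_mul, mul_one]; abel
    rw [this]; exact conj_posSemidef hY H
  have h5 := h2.trans (Real.exp_le_exp.2 h4)
  rw [h1] at h5
  simp only [det_mul, det_one] at h5 h3
  have h6 := mul_le_mul_of_nonneg_left h5 hM.det_pos.le
  calc _ = (H.det * (1 + Y).det * H.det) * (1 + Y + E).det := by rw [h3, one_mul]
    _ ≤ _ := by linarith

/-- **Fischer's inequality**. -/
theorem det_le_mul_det {ν : Type*} [Fintype ν] [DecidableEq ν] {M : Matrix ν ν ℝ} (hM : M.PosDef)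
    (e : ι ⊕ κ ≃ ν) :
    M.det ≤ (M.submatrix (e ∘ Sum.inl) (e ∘ Sum.inl)).det *
      (M.submatrix (e ∘ Sum.inr) (e ∘ Sum.inr)).det := by
  set A := M.submatrix (e ∘ Sum.inl) (e ∘ Sum.inl) with hA
  set D := M.submatrix (e ∘ Sum.inr) (e ∘ Sum.inr) with hD
  set B := M.submatrix (e ∘ Sum.inl) (e ∘ Sum.inr) with hB
  have hAp : A.PosDef := hM.submatrix (e.injective.comp Sum.inl_injective)
  have hblock : M.submatrix e e = fromBlocks A B Bᴴ D := by
    have hs : Mᴴ = M := hM.isHermitian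
    ext i j
    rcases i with i | i <;> rcases j with j | j <;> simp [hA, hB, hD]
    conv_lhs => rw [← hs]
    simp
  have hMp : (fromBlocks A B Bᴴ D).PosDef := hblock ▸ hM.submatrix e.injective
  let _ : Invertible A := hAp.isUnit.invertible
  -- The determinant factors through the Schur complement, which is `D` minus a positive
  -- semidefinite matrix.
  have hS : (D - Bᴴ * A⁻¹ * B).PosSemidef := (PosDef.fromBlocks₁₁ B D hAp).1 hMp.posSemidef
  have hdet : M.det = A.det * (D - Bᴴ * A⁻¹ * B).det := by
    rw [← det_submatrix_equiv_self e, hblock, det_fromBlocks₁₁, invOf_eq_nonsing_inv]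
  have hS' : (D - Bᴴ * A⁻¹ * B).PosDef := by
    refine hS.posDef_iff_det_ne_zero.2 fun h => hM.det_pos.ne' ?_
    rw [hdet, h, mul_zero]
  rw [hdet]
  refine mul_le_mul_of_nonneg_left ?_ hAp.det_pos.le
  simpa using det_le_det_add hS' (hAp.inv.posSemidef.conjTranspose_mul_mul_same B)

end Matrices

/-! ### Powers of stable matrices and the discrete Lyapunov equation. -/

section Lyapunov

open Matrix

-- Gelfand's formula: for any `r` strictly between the spectral radius and `1`, eventually `‖A ^ k‖
-- ≤ r ^ k`.
attribute [local instance] Matrix.linftyOpNormedRing Matrix.linftyOpNormedAlgebra in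
theorem tendsto_pow_of_spectralRadius_lt_one {ι : Type*} [Fintype ι] [DecidableEq ι]
    {A : Matrix ι ι ℂ} (hA : spectralRadius ℂ A < 1) :
    Tendsto (fun k : ℕ => A ^ k) atTop (𝓝 0) := by
  obtain ⟨r, hr, hr1⟩ := exists_between hA
  have hG := spectrum.pow_nnnorm_pow_one_div_tendsto_nhds_spectralRadius A
  have hev : ∀ᶠ k : ℕ in atTop, (‖A ^ k‖₊ : ℝ≥0∞) ≤ r ^ k := by
    filter_upwards [hG.eventually (gt_mem_nhds hr), eventually_gt_atTop 0] with k hk hk0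
    have h1 : ((‖A ^ k‖₊ : ℝ≥0∞) ^ (1 / k : ℝ)) ^ (k : ℝ) ≤ r ^ (k : ℝ) :=
      ENNReal.rpow_le_rpow hk.le (by positivity)
    rw [← ENNReal.rpow_mul, one_div, inv_mul_cancel₀ (by positivity), ENNReal.rpow_one,
      ENNReal.rpow_natCast] at h1
    exact h1
  have h2 : Tendsto (fun k : ℕ => (‖A ^ k‖₊ : ℝ≥0∞)) atTop (𝓝 0) :=
    tendsto_of_tendsto_of_tendsto_of_le_of_le' tendsto_const_nhds
      (ENNReal.tendsto_pow_atTop_nhds_zero_of_lt_one hr1) (Eventually.of_forall fun _ => zero_le)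
      hev
  have h3 : Tendsto (fun k : ℕ => ‖A ^ k‖₊) atTop (𝓝 0) := ENNReal.tendsto_coe.1 h2
  exact tendsto_zero_iff_norm_tendsto_zero.2 (NNReal.tendsto_coe.2 h3)

theorem posSemidef_of_tendsto {ι : Type*} [Fintype ι] {X : ℕ → Matrix ι ι ℝ} {Y : Matrix ι ι ℝ}
    (hX : ∀ k, (X k).PosSemidef) (h : Tendsto X atTop (𝓝 Y)) : Y.PosSemidef := by
  refine PosSemidef.of_dotProduct_mulVec_nonneg ?_ fun v => ?_
  · have h1 : Continuous fun M : Matrix ι ι ℝ => Mᴴ := continuous_id.matrix_conjTranspose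
    have h2 := (h1.tendsto Y).comp h
    refine tendsto_nhds_unique (h2.congr fun k => ?_) h
    exact (hX k).isHermitian
  · have h1 : Continuous fun M : Matrix ι ι ℝ => star v ⬝ᵥ M *ᵥ v := by fun_prop
    exact ge_of_tendsto' ((h1.tendsto Y).comp h) fun k => (hX k).dotProduct_mulVec_nonneg v

variable {ι : Type*} [Fintype ι] [DecidableEq ι]

theorem tendsto_pow_of_spectralRadius_map_lt_one {A : Matrix ι ι ℝ}
    (hA : spectralRadius ℂ (A.map Complex.ofReal) < 1) :
    Tendsto (fun k : ℕ => A ^ k) atTop (𝓝 0) := by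
  have h := tendsto_pow_of_spectralRadius_lt_one hA
  have h1 : Continuous fun M : Matrix ι ι ℂ => M.map Complex.re :=
    continuous_id.matrix_map Complex.continuous_re
  have h2 := (h1.tendsto 0).comp h
  have h3 : (0 : Matrix ι ι ℂ).map Complex.re = 0 := by ext; simp
  rw [h3] at h2
  refine h2.congr fun k => ?_
  have : A.map Complex.ofReal ^ k = (A ^ k).map Complex.ofReal :=
    (Matrix.map_pow A Complex.ofRealHom k).symm
  simp only [Function.comp, this]
  ext; simp

theorem tendsto_transpose_pow {A : Matrix ι ι ℝ} (hA : Tendsto (fun k : ℕ => A ^ k) atTop (𝓝 0)) :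
    Tendsto (fun k : ℕ => Aᵀ ^ k) atTop (𝓝 0) := by
  have h := (continuous_id.matrix_transpose.tendsto (0 : Matrix ι ι ℝ)).comp hA
  simpa [Function.comp_def, transpose_pow] using h

theorem tendsto_conj_pow {A : Matrix ι ι ℝ} (hA : Tendsto (fun k : ℕ => A ^ k) atTop (𝓝 0))
    (X : Matrix ι ι ℝ) : Tendsto (fun k : ℕ => A ^ k * X * (A ^ k)ᵀ) atTop (𝓝 0) := by
  have h1 : Continuous fun M : Matrix ι ι ℝ => M * X * Mᵀ := by fun_prop
  simpa [Function.comp_def] using (h1.tendsto 0).comp hA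

theorem lyapunov_iterate {A X M : Matrix ι ι ℝ} (h : X = A * X * Aᵀ + M) (k : ℕ) :
    X = A ^ k * X * (A ^ k)ᵀ + ∑ j ∈ Finset.range k, A ^ j * M * (A ^ j)ᵀ := by
  induction k with
  | zero => simp
  | succ k ih =>
    have h1 : A ^ k * X * (A ^ k)ᵀ =
        A ^ (k + 1) * X * (A ^ (k + 1))ᵀ + A ^ k * M * (A ^ k)ᵀ := by
      conv_lhs => rw [h]
      rw [pow_succ, transpose_mul]
      simp only [mul_add, add_mul, mul_assoc]
    rw [Finset.sum_range_succ, add_comm (Finset.sum _ _), ← add_assoc, ← h1]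
    exact ih

theorem lyapunov_eq_zero {A X : Matrix ι ι ℝ} (hA : Tendsto (fun k : ℕ => A ^ k) atTop (𝓝 0))
    (h : X = A * X * Aᵀ) : X = 0 := by
  have h1 : ∀ k, A ^ k * X * (A ^ k)ᵀ = X := fun k => by
    simpa using (lyapunov_iterate (M := 0) (by simpa using h) k).symm
  have h2 := tendsto_conj_pow hA X
  simp only [h1] at h2
  exact tendsto_nhds_unique tendsto_const_nhds h2

/-- `X ↦ X - A * X * Aᵀ` is an endomorphism of a finite-dimensional space. It is injective, because
a solution of the homogeneous equation equals `A ^ k * X * (A ^ k)ᵀ` for all `k`, hence it is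
bijective. -/
theorem existsUnique_lyapunov {A : Matrix ι ι ℝ}
    (hA : Tendsto (fun k : ℕ => A ^ k) atTop (𝓝 0)) (M : Matrix ι ι ℝ) :
    ∃! X : Matrix ι ι ℝ, X = A * X * Aᵀ + M := by
  let Φ : Matrix ι ι ℝ →ₗ[ℝ] Matrix ι ι ℝ :=
    LinearMap.id - (LinearMap.mulRight ℝ Aᵀ ∘ₗ LinearMap.mulLeft ℝ A)
  have hΦ : ∀ X, Φ X = X - A * X * Aᵀ := fun X => rfl
  have hinj : Function.Injective Φ := by
    refine (injective_iff_map_eq_zero Φ).2 fun X hX => lyapunov_eq_zero hA ?_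
    rw [hΦ] at hX
    exact sub_eq_zero.1 hX
  have hbij : Function.Bijective Φ := ⟨hinj, LinearMap.surjective_of_injective hinj⟩
  have := hbij.existsUnique M
  simpa only [hΦ, sub_eq_iff_eq_add, add_comm M] using this

/-- Iterating the equation exhibits `X` as the limit of the partial sums of `A ^ j * M * (A ^ j)ᵀ`.
-/
theorem lyapunov_posSemidef {A X M : Matrix ι ι ℝ}
    (hA : Tendsto (fun k : ℕ => A ^ k) atTop (𝓝 0)) (hM : M.PosSemidef)
    (h : X = A * X * Aᵀ + M) : X.PosSemidef := by
  have h1 : Tendsto (fun k : ℕ => ∑ j ∈ Finset.range k, A ^ j * M * (A ^ j)ᵀ) atTop (𝓝 X) := by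
    have := tendsto_const_nhds (x := X) |>.sub (tendsto_conj_pow hA X)
    rw [sub_zero] at this
    refine this.congr fun k => ?_
    rw [sub_eq_iff_eq_add, add_comm]
    exact lyapunov_iterate h k
  exact posSemidef_of_tendsto
    (fun k => posSemidef_sum _ fun j _ => conj_posSemidef hM _) h1

end Lyapunov

/-! ### Growth rates of the trace and log-determinant of the response covariance. -/

section ResponseCovariance

set_option linter.unusedSectionVars false

open Matrix

variable {ι κ ν : Type*} [Fintype ι] [DecidableEq ι] [Fintype κ] [Fintype ν] [DecidableEq ν]

/-- The map from the initial state to the outputs `D x_0, …, D x_{T-1}` of `x⁺ = A x`. -/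
def obsMatrix (A : Matrix ι ι ℝ) (D : Matrix ν ι ℝ) (T : ℕ) : Matrix (Fin T × ν) ι ℝ :=
  of fun k i => (D * A ^ (k.1 : ℕ)) k.2 i

/-- The map from the input at time `j` to the outputs `D x_0, …, D x_{T-1}` of
`x⁺ = A x + B u`. -/
def inputMatrix (A : Matrix ι ι ℝ) (B : Matrix ι κ ℝ) (D : Matrix ν ι ℝ) (T j : ℕ) :
    Matrix (Fin T × ν) κ ℝ :=
  of fun k i => if j < k.1 then (D * (A ^ ((k.1 : ℕ) - 1 - j) * B)) k.2 i else 0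

/-- The covariance of the outputs `D x_0, …, D x_{T-1}` of `x⁺ = A x + B u`, when `x_0` has
covariance `V` and the inputs are white with covariance `W`. -/
def responseCov (A : Matrix ι ι ℝ) (B : Matrix ι κ ℝ) (D : Matrix ν ι ℝ) (W : Matrix κ κ ℝ)
    (V : Matrix ι ι ℝ) (T : ℕ) : Matrix (Fin T × ν) (Fin T × ν) ℝ :=
  obsMatrix A D T * V * (obsMatrix A D T)ᵀ +
    ∑ j ∈ Finset.range T, inputMatrix A B D T j * W * (inputMatrix A B D T j)ᵀ

/-- The covariance of the state `x_k` of `x⁺ = A x + B u`. -/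
def stateCov (A : Matrix ι ι ℝ) (B : Matrix ι κ ℝ) (W : Matrix κ κ ℝ) (V : Matrix ι ι ℝ) :
    ℕ → Matrix ι ι ℝ
  | 0 => V
  | k + 1 => A * stateCov A B W V k * Aᵀ + B * W * Bᵀ

variable (A : Matrix ι ι ℝ) (B : Matrix ι κ ℝ) (D : Matrix ν ι ℝ) (W : Matrix κ κ ℝ)
  (V : Matrix ι ι ℝ)

theorem stateCov_posSemidef {W : Matrix κ κ ℝ} {V : Matrix ι ι ℝ} (hW : W.PosSemidef)
    (hV : V.PosSemidef) (k : ℕ) : (stateCov A B W V k).PosSemidef := by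
  induction k with
  | zero => exact hV
  | succ k ih => exact (conj_posSemidef ih A).add (conj_posSemidef hW B)

theorem responseCov_posSemidef {W : Matrix κ κ ℝ} {V : Matrix ι ι ℝ} (hW : W.PosSemidef)
    (hV : V.PosSemidef) (T : ℕ) : (responseCov A B D W V T).PosSemidef :=
  (conj_posSemidef hV _).add (posSemidef_sum _ fun _ _ => conj_posSemidef hW _)

theorem stateCov_eq (s : ℕ) : stateCov A B W V s = A ^ s * V * (A ^ s)ᵀ +
    ∑ j ∈ Finset.range s, (A ^ (s - 1 - j) * B) * W * (A ^ (s - 1 - j) * B)ᵀ := by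
  induction s with
  | zero => simp [stateCov]
  | succ s ih =>
    rw [stateCov, ih, Finset.sum_range_succ, ← add_assoc, mul_add, add_mul, pow_succ']
    congr 1
    · congr 1
      · simp only [transpose_mul, Matrix.mul_assoc]
      · rw [Finset.mul_sum, Finset.sum_mul]
        refine Finset.sum_congr rfl fun j hj => ?_
        have hj := Finset.mem_range.1 hj
        rw [show s + 1 - 1 - j = (s - 1 - j) + 1 by omega, pow_succ']
        simp only [transpose_mul, Matrix.mul_assoc]
    · simp

theorem submatrix_conj {μ μ' : Type*} (N : Matrix μ ι ℝ) (X : Matrix ι ι ℝ)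
    (f : μ' → μ) : (N * X * Nᵀ).submatrix f f = N.submatrix f id * X * (N.submatrix f id)ᵀ := rfl

theorem submatrix_add_self {μ μ' : Type*} (X Y : Matrix μ μ ℝ) (f : μ' → μ) :
    (X + Y).submatrix f f = X.submatrix f f + Y.submatrix f f := rfl

theorem submatrix_sum {μ μ' σ : Type*} (s : Finset σ) (N : σ → Matrix μ μ ℝ)
    (f : μ' → μ) : (∑ j ∈ s, N j).submatrix f f = ∑ j ∈ s, (N j).submatrix f f := by
  ext a b; simp [Matrix.sum_apply]

theorem obsMatrix_mul_shift (t : ℕ) (s : ℕ) (k : Fin t × ν) :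
    (obsMatrix A D t * A ^ s) k = (D * A ^ (s + k.1)) k.2 := by
  ext i
  have : D * A ^ (s + k.1) = (D * A ^ (k.1 : ℕ)) * A ^ s := by
    rw [Matrix.mul_assoc, ← pow_add, add_comm]
  rw [this]
  rfl

/-- Time invariance and the Markov property: after time `s` the system restarts from the state
covariance reached at `s`. Inputs before `s` are absorbed into that covariance, inputs from `s` on
are shifted. -/
theorem responseCov_submatrix_natAdd (s t : ℕ) :
    (responseCov A B D W V (s + t)).submatrix (fun k : Fin t × ν => (Fin.natAdd s k.1, k.2))
      (fun k : Fin t × ν => (Fin.natAdd s k.1, k.2)) =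
    responseCov A B D W (stateCov A B W V s) t := by
  rw [responseCov, submatrix_add_self, submatrix_sum, submatrix_conj,
    Finset.sum_range_add, responseCov, stateCov_eq,
    Matrix.mul_add, Matrix.add_mul, add_assoc]
  simp only [submatrix_conj]
  congr 1
  · have : (obsMatrix A D (s + t)).submatrix (fun k : Fin t × ν => (Fin.natAdd s k.1, k.2)) id =
        obsMatrix A D t * A ^ s := by
      ext k i
      rw [obsMatrix_mul_shift]; simp [obsMatrix]
    rw [this]
    simp only [transpose_mul, Matrix.mul_assoc]
  · congr 1
    · rw [Matrix.mul_sum, Matrix.sum_mul]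
      refine Finset.sum_congr rfl fun j hj => ?_
      have hj := Finset.mem_range.1 hj
      have : (inputMatrix A B D (s + t) j).submatrix
          (fun k : Fin t × ν => (Fin.natAdd s k.1, k.2)) id =
          obsMatrix A D t * (A ^ (s - 1 - j) * B) := by
        ext k i
        rw [← Matrix.mul_assoc, mul_apply, obsMatrix_mul_shift, ← mul_apply, Matrix.mul_assoc]
        simp only [inputMatrix, submatrix_apply, of_apply, Fin.val_natAdd, id_eq]
        rw [if_pos (by omega), show s + (k.1 : ℕ) - 1 - j = s - 1 - j + k.1 by omega]
      rw [this]
      simp only [transpose_mul, Matrix.mul_assoc]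
    · refine Finset.sum_congr rfl fun j hj => ?_
      have : (inputMatrix A B D (s + t) (s + j)).submatrix
          (fun k : Fin t × ν => (Fin.natAdd s k.1, k.2)) id = inputMatrix A B D t j := by
        ext k i
        simp only [inputMatrix, submatrix_apply, of_apply, Fin.val_natAdd, id_eq]
        simp only [add_lt_add_iff_left, show s + (k.1 : ℕ) - 1 - (s + j) = k.1 - 1 - j by omega]
      rw [this]

/-- Causality: inputs from time `s` on do not reach the first `s` outputs. -/
theorem responseCov_submatrix_castAdd (s t : ℕ) :
    (responseCov A B D W V (s + t)).submatrix (fun k : Fin s × ν => (Fin.castAdd t k.1, k.2))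
      (fun k : Fin s × ν => (Fin.castAdd t k.1, k.2)) =
    responseCov A B D W V s := by
  rw [responseCov, submatrix_add_self, submatrix_sum, submatrix_conj,
    Finset.sum_range_add, responseCov]
  simp only [submatrix_conj]
  congr 1
  refine (add_eq_left.2 ?_).trans rfl
  refine Finset.sum_eq_zero fun j _ => ?_
  have : (inputMatrix A B D (s + t) (s + j)).submatrix
      (fun k : Fin s × ν => (Fin.castAdd t k.1, k.2)) id = 0 := by
    ext k i
    have := k.1.2
    simp only [inputMatrix, submatrix_apply, of_apply, Fin.val_castAdd, id_eq, Matrix.zero_apply]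
    rw [if_neg (by omega)]
  rw [this]; simp

/-- Splitting a time interval of length `s + t`. -/
def timeSplit (ν : Type*) (s t : ℕ) : (Fin s × ν) ⊕ (Fin t × ν) ≃ Fin (s + t) × ν :=
  (Equiv.sumProdDistrib (Fin s) (Fin t) ν).symm.trans (finSumFinEquiv.prodCongr (Equiv.refl ν))

theorem trace_responseCov (T : ℕ) : (responseCov A B D W V T).trace =
    ∑ k ∈ Finset.range T, (D * stateCov A B W V k * Dᵀ).trace := by
  induction T with
  | zero => simp [trace]
  | succ T ih =>
    have h0 : ∀ U, (responseCov A B D W U 1).trace = (D * U * Dᵀ).trace := fun U => by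
      have h1 : inputMatrix A B D 1 0 = 0 := by ext k i; simp [inputMatrix]
      rw [responseCov, Finset.sum_range_one, h1]
      simp only [Matrix.zero_mul, add_zero]
      rw [trace, Fintype.sum_prod_type]
      simp only [Finset.univ_unique, Finset.sum_singleton]
      refine Finset.sum_congr rfl fun i _ => ?_
      have : (obsMatrix A D 1).submatrix (fun i : ν => ((default : Fin 1), i)) id = D := by
        ext; simp [obsMatrix]
      conv_rhs => rw [← this, ← submatrix_conj]
      rfl
    rw [Finset.sum_range_succ, ← ih, ← h0, ← responseCov_submatrix_natAdd,
      ← responseCov_submatrix_castAdd A B D W V T 1, trace,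
      ← (timeSplit ν T 1).sum_comp, Fintype.sum_sum_type]
    rfl

/-- The log-determinant of the covariance of the outputs in unit white noise. -/
noncomputable def logDet (T : ℕ) : ℝ := Real.log (1 + responseCov A B D W V T).det

variable {W V}

theorem one_le_det_responseCov (hW : W.PosSemidef) (hV : V.PosSemidef) (T : ℕ) :
    1 ≤ (1 + responseCov A B D W V T).det :=
  one_le_det_one_add (responseCov_posSemidef A B D hW hV T)

theorem logDet_nonneg (hW : W.PosSemidef) (hV : V.PosSemidef) (T : ℕ) :
    0 ≤ logDet A B D W V T :=
  Real.log_nonneg (one_le_det_responseCov A B D hW hV T)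

theorem logDet_le_trace (hW : W.PosSemidef) (hV : V.PosSemidef) (T : ℕ) :
    logDet A B D W V T ≤ (responseCov A B D W V T).trace := by
  rw [logDet, Real.log_le_iff_le_exp (zero_lt_one.trans_le (one_le_det_responseCov A B D hW hV T))]
  exact det_one_add_le_exp_trace (responseCov_posSemidef A B D hW hV T)

/-- Fischer's inequality for the blocks of past and future outputs. The future block starts from
`stateCov A B W V s` instead of `V`, so this is not yet subadditivity. -/
theorem logDet_add_le (hW : W.PosSemidef) (hV : V.PosSemidef) (s t : ℕ) :
    logDet A B D W V (s + t) ≤ logDet A B D W V s + logDet A B D W (stateCov A B W V s) t := by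
  have hp : (1 + responseCov A B D W V (s + t)).PosDef :=
    PosDef.one.add_posSemidef (responseCov_posSemidef A B D hW hV _)
  have h := det_le_mul_det hp (timeSplit ν s t)
  have h1 : (1 + responseCov A B D W V (s + t)).submatrix (timeSplit ν s t ∘ Sum.inl)
      (timeSplit ν s t ∘ Sum.inl) = 1 + responseCov A B D W V s := by
    rw [← responseCov_submatrix_castAdd A B D W V s t, submatrix_add_self,
      submatrix_one _ ((timeSplit ν s t).injective.comp Sum.inl_injective)]
    rfl
  have h2 : (1 + responseCov A B D W V (s + t)).submatrix (timeSplit ν s t ∘ Sum.inr)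
      (timeSplit ν s t ∘ Sum.inr) = 1 + responseCov A B D W (stateCov A B W V s) t := by
    rw [← responseCov_submatrix_natAdd A B D W V s t, submatrix_add_self,
      submatrix_one _ ((timeSplit ν s t).injective.comp Sum.inr_injective)]
    rfl
  rw [h1, h2] at h
  have h3 := one_le_det_responseCov A B D hW hV s
  have h4 := one_le_det_responseCov A B D hW (stateCov_posSemidef A B hW hV s) t
  rw [logDet, logDet, logDet, ← Real.log_mul (by positivity) (by positivity)]
  exact Real.log_le_log hp.det_pos h

/-- Both initial covariances are compared with zero: adding the contribution of `U` multiplies the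
determinant by at most the exponential of its trace, and removing that of `V` only decreases the
determinant. -/
theorem logDet_le_add_trace {U : Matrix ι ι ℝ} (hW : W.PosSemidef) (hV : V.PosSemidef)
    (hU : U.PosSemidef) (T : ℕ) :
    logDet A B D W U T ≤
      logDet A B D W V T + (obsMatrix A D T * U * (obsMatrix A D T)ᵀ).trace := by
  have h0 : ∀ X : Matrix ι ι ℝ, responseCov A B D W X T =
      responseCov A B D W 0 T + obsMatrix A D T * X * (obsMatrix A D T)ᵀ := fun X => by
    rw [responseCov, responseCov]; simp [add_comm]
  have hp := responseCov_posSemidef A B D hW PosSemidef.zero T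
  have h1 := det_add_le hp (conj_posSemidef hU (obsMatrix A D T))
  have h2 := det_le_det_add (PosDef.one.add_posSemidef hp) (conj_posSemidef hV (obsMatrix A D T))
  rw [add_assoc, ← h0] at h1 h2
  have h3 := one_le_det_responseCov A B D hW hV T
  rw [logDet, logDet, ← Real.log_exp (trace _), ← Real.log_mul (by positivity) (by positivity)]
  refine Real.log_le_log (zero_lt_one.trans_le (one_le_det_responseCov A B D hW hU T)) ?_
  exact h1.trans (mul_le_mul_of_nonneg_right h2 (Real.exp_pos _).le)

/-- Cyclicity of the trace moves the powers of `A` from the covariance `U` to `Dᵀ * D`, which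
produces the partial sums of the observability Gramian. -/
theorem trace_obsMatrix_conj (U : Matrix ι ι ℝ) (T : ℕ) :
    (obsMatrix A D T * U * (obsMatrix A D T)ᵀ).trace =
      ∑ k ∈ Finset.range T, (Aᵀ ^ k * (Dᵀ * D) * (Aᵀ ^ k)ᵀ * U).trace := by
  have h := trace_responseCov A (0 : Matrix ι (Fin 0) ℝ) D 0 U T
  simp only [responseCov, Matrix.mul_zero, Matrix.zero_mul, Finset.sum_const_zero, add_zero] at h
  rw [h]
  refine Finset.sum_congr rfl fun k _ => ?_
  rw [stateCov_eq]
  simp only [Matrix.mul_zero, Matrix.zero_mul, Finset.sum_const_zero, add_zero]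
  have hT : (Aᵀ ^ k)ᵀ = A ^ k := by simp
  rw [hT, transpose_pow, trace_mul_comm,
    show Dᵀ * (D * (A ^ k * U * Aᵀ ^ k)) = (Dᵀ * D * A ^ k * U) * Aᵀ ^ k by
      simp only [Matrix.mul_assoc], trace_mul_comm]
  simp only [Matrix.mul_assoc]

variable {A}

/-- `X` is the observability Gramian. It bounds, uniformly in the horizon, the effect of the initial
covariance on the outputs. -/
theorem trace_obsMatrix_conj_le (hA : Tendsto (fun k : ℕ => A ^ k) atTop (𝓝 0))
    {X U : Matrix ι ι ℝ} (hX : X = Aᵀ * X * Aᵀᵀ + Dᵀ * D) (hU : U.PosSemidef) (T : ℕ) :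
    (obsMatrix A D T * U * (obsMatrix A D T)ᵀ).trace ≤ (X * U).trace := by
  have hXp : X.PosSemidef := lyapunov_posSemidef (tendsto_transpose_pow hA)
    (by simpa using posSemidef_conjTranspose_mul_self D) hX
  have h1 := lyapunov_iterate hX T
  rw [trace_obsMatrix_conj, ← trace_sum, ← Finset.sum_mul]
  have h2 : 0 ≤ (Aᵀ ^ T * X * (Aᵀ ^ T)ᵀ * U).trace := by
    obtain ⟨R, hRT, rfl⟩ := exists_sqrt hU
    rw [← Matrix.mul_assoc, trace_mul_comm, ← Matrix.mul_assoc]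
    nth_rw 2 [← hRT]
    exact (conj_posSemidef (conj_posSemidef hXp _) R).trace_nonneg
  conv_rhs => rw [h1, add_mul, trace_add]
  linarith

/-- The deviation from the fixed point `S` is exactly `A ^ k * (V - S) * (A ^ k)ᵀ`. -/
theorem tendsto_stateCov (hA : Tendsto (fun k : ℕ => A ^ k) atTop (𝓝 0)) {S : Matrix ι ι ℝ}
    (hS : S = A * S * Aᵀ + B * W * Bᵀ) (V : Matrix ι ι ℝ) :
    Tendsto (stateCov A B W V) atTop (𝓝 S) := by
  have h : ∀ k, stateCov A B W V k = S + A ^ k * (V - S) * (A ^ k)ᵀ := fun k => by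
    induction k with
    | zero => simp [stateCov]
    | succ k ih =>
      rw [stateCov, ih, pow_succ']
      nth_rw 3 [hS]
      simp only [mul_add, add_mul, transpose_mul, Matrix.mul_assoc]
      abel
  have h1 := (tendsto_conj_pow hA (V - S)).const_add S
  rw [add_zero] at h1
  exact h1.congr fun k => (h k).symm

theorem tendsto_trace_responseCov (hA : Tendsto (fun k : ℕ => A ^ k) atTop (𝓝 0))
    {S : Matrix ι ι ℝ} (hS : S = A * S * Aᵀ + B * W * Bᵀ) (V : Matrix ι ι ℝ) :
    Tendsto (fun T : ℕ => (responseCov A B D W V T).trace / T) atTop (𝓝 (D * S * Dᵀ).trace) := by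
  have h1 : Continuous fun X : Matrix ι ι ℝ => (D * X * Dᵀ).trace := by fun_prop
  have h2 := ((h1.tendsto S).comp (tendsto_stateCov B hA hS V)).cesaro
  refine h2.congr fun T => ?_
  rw [trace_responseCov, div_eq_inv_mul]
  rfl

/-- Fekete's lemma. Restarting at time `s` with the current state covariance instead of `V` costs a
bounded amount, so adding a constant to `logDet` makes it subadditive. -/
theorem exists_tendsto_logDet (hA : Tendsto (fun k : ℕ => A ^ k) atTop (𝓝 0))
    (hW : W.PosSemidef) (hV : V.PosSemidef) :
    ∃ φ : ℝ, Tendsto (fun T : ℕ => logDet A B D W V T / T) atTop (𝓝 φ) := by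
  obtain ⟨X, hX, -⟩ := existsUnique_lyapunov (tendsto_transpose_pow hA) (Dᵀ * D)
  obtain ⟨S, hS, -⟩ := existsUnique_lyapunov hA (B * W * Bᵀ)
  have h1 : Continuous fun U : Matrix ι ι ℝ => (X * U).trace := by fun_prop
  -- The constant `c` bounds the Gramian cost of every restart; it is finite because the state
  -- covariances converge.
  obtain ⟨c, hc⟩ := ((h1.tendsto S).comp (tendsto_stateCov B hA hS V)).bddAbove_range
  have hc : ∀ s, (X * stateCov A B W V s).trace ≤ c := fun s => hc ⟨s, rfl⟩
  have hsub : Subadditive fun T => logDet A B D W V T + c := fun s t => by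
    have hs := stateCov_posSemidef A B hW hV s
    have a1 := logDet_add_le A B D hW hV s t
    have a2 := logDet_le_add_trace A B D hW hV hs t
    have a3 := trace_obsMatrix_conj_le D hA hX hs t
    linarith [hc s]
  have hc0 : 0 ≤ c := by
    have a3 := trace_obsMatrix_conj_le D hA hX hV 0
    have := hc 0
    simp only [trace, Finset.univ_eq_empty, Finset.sum_empty] at a3
    exact a3.trans this
  have hbdd : BddBelow (Set.range fun T : ℕ => (logDet A B D W V T + c) / T) := by
    refine ⟨0, ?_⟩
    rintro _ ⟨T, rfl⟩
    have := logDet_nonneg A B D hW hV T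
    positivity
  refine ⟨hsub.lim - 0, ((hsub.tendsto_lim hbdd).sub
    (tendsto_const_div_atTop_nhds_zero_nat c)).congr fun T => ?_⟩
  ring

end ResponseCovariance

/-! ### Divergence of a Gaussian vector from the standard one. -/

section GaussianDivergence

open Matrix

/-- The density of the standard Gaussian measure. -/
noncomputable def stdGaussianDensity (E : Type*) [NormedAddCommGroup E] [InnerProductSpace ℝ E]
    (x : E) : ℝ :=
  (2 * Real.pi) ^ (-(Module.finrank ℝ E : ℝ) / 2) * Real.exp (-‖x‖ ^ 2 / 2)

/-- The characteristic functions agree: that of the density is the Gaussian Fourier integral at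
parameter `1 / 2`. -/
theorem stdGaussian_eq_withDensity (E : Type*) [NormedAddCommGroup E] [InnerProductSpace ℝ E]
    [FiniteDimensional ℝ E] [MeasurableSpace E] [BorelSpace E] :
    stdGaussian E = volume.withDensity fun x => ENNReal.ofReal (stdGaussianDensity E x) := by
  have hnn : ∀ x, 0 ≤ stdGaussianDensity E x := fun x => by unfold stdGaussianDensity; positivity
  have hmeas : Measurable (stdGaussianDensity E) := by unfold stdGaussianDensity; fun_prop
  have hb : 0 < (1 / 2 : ℂ).re := by norm_num
  have hint : Integrable (stdGaussianDensity E) volume := by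
    have h := (GaussianFourier.integrable_cexp_neg_mul_sq_norm_add hb 0 (0 : E)).re
    refine (h.const_mul ((2 * Real.pi) ^ (-(Module.finrank ℝ E : ℝ) / 2))).congr
      (Eventually.of_forall fun x => ?_)
    simp only [stdGaussianDensity]
    congr 1
    have : (-(1 / 2 : ℂ) * (‖x‖ : ℂ) ^ 2 + 0 * (inner ℝ (0 : E) x : ℝ)) =
        ((-‖x‖ ^ 2 / 2 : ℝ) : ℂ) := by push_cast; ring
    rw [this, ← Complex.ofReal_exp]; rfl
  have hfin : IsFiniteMeasure
      (volume.withDensity fun x => ENNReal.ofReal (stdGaussianDensity E x)) :=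
    isFiniteMeasure_withDensity_ofReal hint.2
  refine Measure.ext_of_charFun ?_
  ext t
  rw [charFun_stdGaussian, charFun_apply, integral_withDensity_eq_integral_toReal_smul
    hmeas.ennreal_ofReal (by simp)]
  have h1 := GaussianFourier.integral_cexp_neg_mul_sq_norm_add hb Complex.I t
  have h2 : ∀ x : E, (ENNReal.ofReal (stdGaussianDensity E x)).toReal •
      Complex.exp ((inner ℝ x t : ℝ) * Complex.I) =
      (((2 * Real.pi) ^ (-(Module.finrank ℝ E : ℝ) / 2) : ℝ) : ℂ) *
        Complex.exp (-(1 / 2) * (‖x‖ : ℂ) ^ 2 + Complex.I * (inner ℝ t x : ℝ)) := fun x => by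
    rw [ENNReal.toReal_ofReal (hnn x), stdGaussianDensity, Complex.real_smul, Complex.ofReal_mul,
      mul_assoc, Complex.ofReal_exp, ← Complex.exp_add, real_inner_comm]
    congr 2
    push_cast; ring
  simp_rw [h2]
  rw [integral_const_mul, h1]
  have h3 : ((Real.pi : ℂ) / (1 / 2)) ^ ((Module.finrank ℝ E : ℂ) / 2) =
      (((2 * Real.pi) ^ ((Module.finrank ℝ E : ℝ) / 2) : ℝ) : ℂ) := by
    rw [Complex.ofReal_cpow (by positivity)]
    push_cast
    congr 1; ring
  rw [h3, ← mul_assoc, ← Complex.ofReal_mul, ← Real.rpow_add (by positivity)]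
  have h4 : -(Module.finrank ℝ E : ℝ) / 2 + (Module.finrank ℝ E : ℝ) / 2 = 0 := by ring
  rw [h4, Real.rpow_zero, Complex.I_sq]
  simp only [Complex.ofReal_one, one_mul]
  congr 1; ring

theorem map_withDensity_comp {α β : Type*} [MeasurableSpace α] [MeasurableSpace β] (μ : Measure α)
    {f : α → β} (hf : Measurable f) {g : β → ℝ≥0∞} (hg : Measurable g) :
    (μ.withDensity (g ∘ f)).map f = (μ.map f).withDensity g := by
  ext s hs
  rw [Measure.map_apply hf hs, withDensity_apply _ (hf hs), withDensity_apply _ hs,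
    setLIntegral_map hs hg hf]
  rfl

/-- The Kullback-Leibler divergence of a measure given by a density of the form `exp ℓ`. -/
theorem klDiv_withDensity_exp {α : Type*} [MeasurableSpace α] {μ ν : Measure α}
    [IsProbabilityMeasure μ] [IsProbabilityMeasure ν] {l : α → ℝ} (hl : Measurable l)
    (h : μ = ν.withDensity fun x => ENNReal.ofReal (Real.exp (l x))) (hint : Integrable l μ) :
    klDiv μ ν = ENNReal.ofReal (∫ x, l x ∂μ) := by
  have hac : μ ≪ ν := h ▸ withDensity_absolutelyContinuous _ _
  have h1 : llr μ ν =ᵐ[μ] l := by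
    refine hac.ae_le ?_
    have := Measure.rnDeriv_withDensity ν (f := fun x => ENNReal.ofReal (Real.exp (l x)))
      (by fun_prop)
    rw [← h] at this
    filter_upwards [this] with x hx
    rw [llr, hx, ENNReal.toReal_ofReal (Real.exp_pos _).le, Real.log_exp]
  rw [klDiv_of_ac_of_integrable hac (hint.congr h1.symm), integral_congr_ae h1]
  simp

variable {ι : Type*} [Fintype ι] [DecidableEq ι]

theorem memLp_two_eval_multivariateGaussian (μ : EuclideanSpace ℝ ι) (S : Matrix ι ι ℝ) (i : ι) :
    MemLp (fun x : EuclideanSpace ℝ ι => x i) 2 (multivariateGaussian μ S) := by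
  have h : MemLp id 2 (multivariateGaussian μ S) := IsGaussian.memLp_two_id
  exact (EuclideanSpace.proj i : EuclideanSpace ℝ ι →L[ℝ] ℝ).comp_memLp' h

theorem integrable_norm_sq_multivariateGaussian (μ : EuclideanSpace ℝ ι) (S : Matrix ι ι ℝ) :
    Integrable (fun x => ‖x‖ ^ 2) (multivariateGaussian μ S) := by
  have h : MemLp id 2 (multivariateGaussian μ S) := IsGaussian.memLp_two_id
  exact h.integrable_norm_pow (by norm_num)

theorem integral_eval_multivariateGaussian (μ : EuclideanSpace ℝ ι) (S : Matrix ι ι ℝ) (i : ι) :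
    ∫ x : EuclideanSpace ℝ ι, x i ∂multivariateGaussian μ S = μ i := by
  have := (EuclideanSpace.proj i : EuclideanSpace ℝ ι →L[ℝ] ℝ).integral_comp_comm
    (IsGaussian.integrable_id (μ := multivariateGaussian μ S))
  simpa using this

theorem integral_norm_sq_multivariateGaussian (μ : EuclideanSpace ℝ ι) {S : Matrix ι ι ℝ}
    (hS : S.PosSemidef) : ∫ x, ‖x‖ ^ 2 ∂multivariateGaussian μ S = ‖μ‖ ^ 2 + S.trace := by
  simp_rw [EuclideanSpace.real_norm_sq_eq]
  have hm := memLp_two_eval_multivariateGaussian μ S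
  rw [integral_finsetSum _ fun i _ => (hm i).integrable_sq, trace, ← Finset.sum_add_distrib]
  refine Finset.sum_congr rfl fun i _ => ?_
  have h1 := variance_eval_multivariateGaussian (μ := μ) hS i
  rw [variance_eq_sub (hm i)] at h1
  rw [integral_eval_multivariateGaussian] at h1
  simp only [diag_apply, ← h1]
  simp

-- The law is the image of the standard one under `x ↦ μ + R x` with `R = S ^ (1/2)`. A change of
-- variables gives its density relative to the standard Gaussian, and the divergence is the mean of
-- the log-density, computed from second moments.
open scoped MatrixOrder in
theorem klDiv_multivariateGaussian_stdGaussian (μ : EuclideanSpace ℝ ι) {S : Matrix ι ι ℝ}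
    (hS : S.PosDef) :
    klDiv (multivariateGaussian μ S) (stdGaussian (EuclideanSpace ℝ ι)) =
      ENNReal.ofReal ((S.trace - Fintype.card ι - Real.log S.det + ‖μ‖ ^ 2) / 2) := by
  set R := CFC.sqrt S with hR
  have hRR : R * R = S := CFC.sqrt_mul_sqrt_self _ hS.posSemidef.nonneg
  have hdet2 : R.det ^ 2 = S.det := by rw [sq, ← det_mul, hRR]
  have hdet : R.det ≠ 0 := fun h => hS.det_pos.ne' (by rw [← hdet2, h]; simp)
  have hlog : Real.log |R.det| = Real.log S.det / 2 := by
    rw [Real.log_abs, ← hdet2, Real.log_pow]; push_cast; ring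
  let F : EuclideanSpace ℝ ι →L[ℝ] EuclideanSpace ℝ ι := toEuclideanCLM (𝕜 := ℝ) R
  let G : EuclideanSpace ℝ ι →L[ℝ] EuclideanSpace ℝ ι := toEuclideanCLM (𝕜 := ℝ) R⁻¹
  have hGF : ∀ x, G (F x) = x := fun x => by
    have : G * F = 1 := by
      rw [← map_mul, nonsing_inv_mul _ (isUnit_iff_ne_zero.2 hdet), map_one]
    exact congrArg (fun f : EuclideanSpace ℝ ι →L[ℝ] EuclideanSpace ℝ ι => f x) this
  let T : EuclideanSpace ℝ ι → EuclideanSpace ℝ ι := fun x => μ + F x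
  let T' : EuclideanSpace ℝ ι → EuclideanSpace ℝ ι := fun y => G (y - μ)
  have hT : Measurable T := by fun_prop
  have hT' : Measurable T' := by fun_prop
  have hT'T : ∀ x, T' (T x) = x := fun x => by simp [T', T, hGF]
  have hdef : multivariateGaussian μ S = (stdGaussian (EuclideanSpace ℝ ι)).map T := rfl
  -- The log-density relative to the standard Gaussian. Under the law of `y`, the whitened vector
  -- `T' y` is standard, so its squared norm has mean `Fintype.card ι`.
  let l : EuclideanSpace ℝ ι → ℝ := fun y => (‖y‖ ^ 2 - ‖T' y‖ ^ 2) / 2 - Real.log |R.det|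
  have hl : Measurable l := by fun_prop
  have hvol : (volume : Measure (EuclideanSpace ℝ ι)).map T = ENNReal.ofReal |R.det|⁻¹ • volume := by
    have hFdet : LinearMap.det (F : EuclideanSpace ℝ ι →ₗ[ℝ] EuclideanSpace ℝ ι) = R.det := by
      have : (F : EuclideanSpace ℝ ι →ₗ[ℝ] EuclideanSpace ℝ ι) =
        toLin (PiLp.basisFun 2 ℝ ι) (PiLp.basisFun 2 ℝ ι) R := rfl
      rw [this, LinearMap.det_toLin]
    have h1 := Measure.map_linearMap_addHaar_eq_smul_addHaar (volume : Measure (EuclideanSpace ℝ ι))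
      (f := (F : EuclideanSpace ℝ ι →ₗ[ℝ] EuclideanSpace ℝ ι)) (by rwa [hFdet])
    have h2 : T = (fun x => μ + x) ∘ F := rfl
    rw [h2, ← Measure.map_map (by fun_prop) (by fun_prop)]
    change (volume.map (F : EuclideanSpace ℝ ι →ₗ[ℝ] EuclideanSpace ℝ ι)).map _ = _
    rw [h1, Measure.map_smul, hFdet, abs_inv, map_add_left_eq_self]
  have hmeas : Measurable (stdGaussianDensity (EuclideanSpace ℝ ι)) := by
    unfold stdGaussianDensity; fun_prop
  have hdens : multivariateGaussian μ S =
      (stdGaussian (EuclideanSpace ℝ ι)).withDensity fun x => ENNReal.ofReal (Real.exp (l x)) := by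
    have hcomp : (fun x => ENNReal.ofReal (stdGaussianDensity (EuclideanSpace ℝ ι) x)) =
        (fun y => ENNReal.ofReal (stdGaussianDensity (EuclideanSpace ℝ ι) (T' y))) ∘ T := by
      ext x; simp [hT'T]
    rw [hdef, stdGaussian_eq_withDensity, ← withDensity_mul _ hmeas.ennreal_ofReal (by fun_prop)]
    conv_lhs => rw [hcomp]
    rw [map_withDensity_comp _ hT (by fun_prop), hvol, withDensity_smul_measure,
      ← withDensity_smul _ (by fun_prop)]
    congr 1
    ext y
    simp only [Pi.smul_apply, Pi.mul_apply, smul_eq_mul]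
    rw [← ENNReal.ofReal_mul (by positivity),
      ← ENNReal.ofReal_mul (by unfold stdGaussianDensity; positivity)]
    congr 1
    have : |R.det|⁻¹ = Real.exp (-Real.log |R.det|) := by
      rw [Real.exp_neg, Real.exp_log (abs_pos.2 hdet)]
    simp only [stdGaussianDensity, l, this]
    rw [mul_left_comm, mul_assoc, ← Real.exp_add, ← Real.exp_add]
    congr 2; ring
  have hi1 := integrable_norm_sq_multivariateGaussian μ S
  have hstd := (multivariateGaussian_zero_one (ι := ι)).symm
  have hi2 : Integrable (fun x => ‖T' x‖ ^ 2) (multivariateGaussian μ S) := by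
    rw [hdef, integrable_map_measure (by fun_prop) hT.aemeasurable]
    simp only [Function.comp_def, hT'T]
    exact hstd ▸ integrable_norm_sq_multivariateGaussian 0 1
  have hv2 : ∫ x, ‖T' x‖ ^ 2 ∂multivariateGaussian μ S = Fintype.card ι := by
    rw [hdef, integral_map hT.aemeasurable (by fun_prop)]
    simp only [hT'T]
    rw [hstd, integral_norm_sq_multivariateGaussian 0 PosSemidef.one]
    simp
  have hi3 : Integrable (fun x => (‖x‖ ^ 2 - ‖T' x‖ ^ 2) / 2) (multivariateGaussian μ S) :=
    (hi1.sub hi2).div_const 2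
  rw [klDiv_withDensity_exp hl hdens (hi3.sub (integrable_const _))]
  congr 1
  change ∫ x, ((‖x‖ ^ 2 - ‖T' x‖ ^ 2) / 2 - Real.log |R.det|) ∂_ = _
  rw [integral_sub hi3 (integrable_const _), integral_div,
    integral_sub hi1 hi2, hv2, integral_norm_sq_multivariateGaussian μ hS.posSemidef, hlog]
  simp
  ring

end GaussianDivergence

/-! ### A strong law for uncorrelated variables, and auxiliary estimates. -/

section StrongLaw

variable {Ω : Type*} [MeasurableSpace Ω] {μ : Measure Ω}

/-- The sum of the `g n` has finite integral, so almost everywhere the series converges and its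
terms vanish in the limit. -/
theorem ae_tendsto_zero_of_summable_integral {g : ℕ → Ω → ℝ} (hg0 : ∀ n ω, 0 ≤ g n ω)
    (hg : ∀ n, Integrable (g n) μ) {c : ℕ → ℝ} (hc : Summable c) (h : ∀ n, ∫ ω, g n ω ∂μ ≤ c n) :
    ∀ᵐ ω ∂μ, Tendsto (fun n => g n ω) atTop (𝓝 0) := by
  have h1 : ∫⁻ ω, ∑' n, ENNReal.ofReal (g n ω) ∂μ ≠ ∞ := by
    rw [lintegral_tsum fun n => (hg n).aestronglyMeasurable.aemeasurable.ennreal_ofReal]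
    have h2 : ∀ n, ∫⁻ ω, ENNReal.ofReal (g n ω) ∂μ ≤ ENNReal.ofReal (c n) := fun n => by
      rw [← ofReal_integral_eq_lintegral_ofReal (hg n) (Eventually.of_forall (hg0 n))]
      exact ENNReal.ofReal_le_ofReal (h n)
    exact ((ENNReal.tsum_le_tsum h2).trans_lt hc.tsum_ofReal_lt_top).ne
  have h3 := ae_lt_top' (AEMeasurable.tsum fun n =>
    (hg n).aestronglyMeasurable.aemeasurable.ennreal_ofReal) h1
  filter_upwards [h3] with ω hω
  have h4 := ENNReal.tendsto_atTop_zero_of_tsum_ne_top hω.ne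
  have h5 := (ENNReal.tendsto_toReal ENNReal.zero_ne_top).comp h4
  refine h5.congr fun n => ?_
  exact ENNReal.toReal_ofReal (hg0 n ω)

theorem integral_sq_sum_le {D : ℕ → Ω → ℝ} (hD : ∀ k, MemLp (D k) 2 μ) {C : ℝ}
    (hC : ∀ k, ∫ ω, D k ω ^ 2 ∂μ ≤ C) (h : ∀ k l, l < k → ∫ ω, D l ω * D k ω ∂μ = 0) (T : ℕ) :
    ∫ ω, (∑ k ∈ Finset.range T, D k ω) ^ 2 ∂μ ≤ C * T := by
  induction T with
  | zero => simp
  | succ T ih =>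
    have hS : MemLp (fun ω => ∑ k ∈ Finset.range T, D k ω) 2 μ :=
      memLp_finsetSum _ fun k _ => hD k
    have h1 : ∀ ω, (∑ k ∈ Finset.range (T + 1), D k ω) ^ 2 =
        (∑ k ∈ Finset.range T, D k ω) ^ 2 + 2 * (∑ k ∈ Finset.range T, D k ω * D T ω)
          + D T ω ^ 2 := fun ω => by
      rw [Finset.sum_range_succ, ← Finset.sum_mul]; ring
    have hi : ∀ k, Integrable (fun ω => D k ω * D T ω) μ := fun k => (hD k).integrable_mul (hD T)
    have hi1 : Integrable (fun ω => 2 * ∑ k ∈ Finset.range T, D k ω * D T ω) μ :=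
      (integrable_finsetSum _ fun k _ => hi k).const_mul 2
    have hi2 : Integrable (fun ω => (∑ k ∈ Finset.range T, D k ω) ^ 2 +
        2 * ∑ k ∈ Finset.range T, D k ω * D T ω) μ := hS.integrable_sq.add hi1
    simp_rw [h1]
    rw [integral_add hi2 (hD T).integrable_sq,
      integral_add hS.integrable_sq hi1, integral_const_mul, integral_finsetSum _ fun k _ => hi k,
      Finset.sum_eq_zero fun k hk => h T k (Finset.mem_range.1 hk)]
    push_cast
    linarith [hC T]

/-- **Strong law of large numbers** for uncorrelated variables with bounded second moments. -/
theorem ae_tendsto_average_of_uncorrelated {D : ℕ → Ω → ℝ} (hD : ∀ k, MemLp (D k) 2 μ) {C : ℝ}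
    (hC : ∀ k, ∫ ω, D k ω ^ 2 ∂μ ≤ C) (h : ∀ k l, l < k → ∫ ω, D l ω * D k ω ∂μ = 0) :
    ∀ᵐ ω ∂μ, Tendsto (fun T : ℕ => (∑ k ∈ Finset.range T, D k ω) / T) atTop (𝓝 0) := by
  have hC0 : 0 ≤ C := (integral_nonneg fun ω => sq_nonneg (D 0 ω)).trans (hC 0)
  -- Control the partial sums along the squares `n ^ 2`, and use `b n` to dominate the fluctuation
  -- up to the next square. Both have second moment of order `n ^ 2`, so after division by `n ^ 4`
  -- they are summable.
  let S : ℕ → Ω → ℝ := fun T ω => ∑ k ∈ Finset.range T, D k ω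
  let b : ℕ → Ω → ℝ := fun n ω => ∑ k ∈ Finset.Ico (n ^ 2) ((n + 1) ^ 2), |D k ω|
  have hS : ∀ T, MemLp (S T) 2 μ := fun T => memLp_finsetSum _ fun k _ => hD k
  have hb : ∀ n, MemLp (b n) 2 μ := fun n => memLp_finsetSum _ fun k _ => (hD k).abs
  have hbC : ∀ n, ∫ ω, b n ω ^ 2 ∂μ ≤ C * (2 * n + 1) ^ 2 := fun n => by
    have hcard : (Finset.Ico (n ^ 2) ((n + 1) ^ 2)).card = 2 * n + 1 := by
      rw [Nat.card_Ico]; ring_nf; omega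
    have h1 : ∀ ω, b n ω ^ 2 ≤ (2 * n + 1) * ∑ k ∈ Finset.Ico (n ^ 2) ((n + 1) ^ 2), D k ω ^ 2 :=
      fun ω => by
        have := sq_sum_le_card_mul_sum_sq (s := Finset.Ico (n ^ 2) ((n + 1) ^ 2))
          (f := fun k => |D k ω|)
        simp only [hcard, sq_abs] at this
        exact_mod_cast this
    have hi : Integrable
        (fun ω => (2 * n + 1) * ∑ k ∈ Finset.Ico (n ^ 2) ((n + 1) ^ 2), D k ω ^ 2) μ :=
      (integrable_finsetSum _ fun k _ => (hD k).integrable_sq).const_mul _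
    refine (integral_mono (hb n).integrable_sq hi h1).trans ?_
    rw [integral_const_mul, integral_finsetSum _ fun k _ => (hD k).integrable_sq]
    have h2 := Finset.sum_le_card_nsmul (Finset.Ico (n ^ 2) ((n + 1) ^ 2))
      (fun k => ∫ ω, D k ω ^ 2 ∂μ) C fun k _ => hC k
    rw [hcard, nsmul_eq_mul] at h2
    push_cast at h2
    nlinarith
  let g : ℕ → Ω → ℝ := fun n ω => (S (n ^ 2) ω ^ 2 + b n ω ^ 2) * ((n : ℝ) ^ 4)⁻¹
  have hg0 : ∀ n ω, 0 ≤ g n ω := fun n ω => by positivity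
  have hgi : ∀ n, Integrable (g n) μ := fun n =>
    ((hS _).integrable_sq.add (hb n).integrable_sq).mul_const _
  have hgc : ∀ n, ∫ ω, g n ω ∂μ ≤ 10 * C * ((n : ℝ) ^ 2)⁻¹ := fun n => by
    change ∫ ω, (S (n ^ 2) ω ^ 2 + b n ω ^ 2) * ((n : ℝ) ^ 4)⁻¹ ∂μ ≤ _
    rw [integral_mul_const, integral_add (hS _).integrable_sq (hb n).integrable_sq]
    rcases Nat.eq_zero_or_pos n with rfl | hn
    · simp
    have h1 := integral_sq_sum_le hD hC h (n ^ 2)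
    have hn1 : (1 : ℝ) ≤ n := by exact_mod_cast hn
    -- The constant is `10 = 1 + 9`: orthogonality gives `C * n ^ 2` for the partial sum, and `2 * n
    -- + 1 ≤ 3 * n` gives `9 * C * n ^ 2` for the block.
    have h2 : ∫ ω, S (n ^ 2) ω ^ 2 ∂μ + ∫ ω, b n ω ^ 2 ∂μ ≤ 10 * C * (n : ℝ) ^ 2 := by
      have h3 := hbC n
      push_cast at h1
      have h4 : C * (2 * (n : ℝ) + 1) ^ 2 ≤ C * (3 * n) ^ 2 := by gcongr; linarith
      change ∫ ω, S (n ^ 2) ω ^ 2 ∂μ ≤ _ at h1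
      nlinarith
    refine (mul_le_mul_of_nonneg_right h2 (by positivity)).trans_eq ?_
    field_simp
  have hsum : Summable fun n : ℕ => 10 * C * ((n : ℝ) ^ 2)⁻¹ :=
    (Real.summable_nat_pow_inv.2 (by norm_num)).mul_left _
  filter_upwards [ae_tendsto_zero_of_summable_integral hg0 hgi hsum hgc] with ω hω
  have hsqrt : Tendsto Nat.sqrt atTop atTop := by
    refine tendsto_atTop.2 fun n => ?_
    filter_upwards [eventually_ge_atTop (n * n)] with T hT
    exact Nat.le_sqrt.2 hT
  have h1 : Tendsto (fun T : ℕ => 2 * g T.sqrt ω) atTop (𝓝 0) := by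
    simpa using (hω.comp hsqrt).const_mul 2
  have h2 : ∀ᶠ T : ℕ in atTop, (S T ω / T) ^ 2 ≤ 2 * g T.sqrt ω := by
    filter_upwards [eventually_ge_atTop 1] with T hT
    set n := T.sqrt with hn
    have hn1 : 1 ≤ n := Nat.le_sqrt.2 (by simpa using hT)
    have hlo : n ^ 2 ≤ T := by rw [sq]; exact Nat.sqrt_le T
    have hhi : T ≤ (n + 1) ^ 2 := by rw [sq]; exact (Nat.lt_succ_sqrt T).le
    have hST : |S T ω| ≤ |S (n ^ 2) ω| + b n ω := by
      have : S T ω = S (n ^ 2) ω + ∑ k ∈ Finset.Ico (n ^ 2) T, D k ω :=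
        (Finset.sum_range_add_sum_Ico (fun k => D k ω) hlo).symm
      rw [this]
      refine (abs_add_le _ _).trans ?_
      gcongr
      refine (Finset.abs_sum_le_sum_abs _ _).trans ?_
      exact Finset.sum_le_sum_of_subset_of_nonneg (Finset.Ico_subset_Ico_right hhi)
        fun k _ _ => abs_nonneg _
    have hn1' : (1 : ℝ) ≤ n := by exact_mod_cast hn1
    have hlo' : (n : ℝ) ^ 2 ≤ T := by exact_mod_cast hlo
    have h3 : S T ω ^ 2 ≤ 2 * (S (n ^ 2) ω ^ 2 + b n ω ^ 2) := by
      have h4 : S T ω ^ 2 ≤ (|S (n ^ 2) ω| + b n ω) ^ 2 := by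
        rw [← sq_abs (S T ω)]; gcongr
      nlinarith [sq_nonneg (|S (n ^ 2) ω| - b n ω), sq_abs (S (n ^ 2) ω)]
    calc (S T ω / T) ^ 2 = S T ω ^ 2 / (T : ℝ) ^ 2 := div_pow _ _ _
      _ ≤ 2 * (S (n ^ 2) ω ^ 2 + b n ω ^ 2) / ((n : ℝ) ^ 2) ^ 2 := by gcongr
      _ = 2 * g n ω := by simp only [g]; rw [← pow_mul]; ring
  have h3 := squeeze_zero' (Eventually.of_forall fun T => sq_nonneg _) h2 h1
  have h4 := (Real.continuous_sqrt.tendsto 0).comp h3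
  simp only [Function.comp_def, Real.sqrt_sq_eq_abs, Real.sqrt_zero] at h4
  exact tendsto_zero_iff_abs_tendsto_zero _ |>.2 h4

theorem tendsto_zero_of_le_mul_add {u c : ℕ → ℝ} {r : ℝ} (hu : ∀ k, 0 ≤ u k) (hr0 : 0 ≤ r)
    (hr1 : r < 1) (h : ∀ k, u (k + 1) ≤ r * u k + c k) (hc : Tendsto c atTop (𝓝 0)) :
    Tendsto u atTop (𝓝 0) := by
  refine Metric.tendsto_atTop.2 fun ε hε => ?_
  -- With the perturbation below this threshold, the recursion has its fixed point at `ε / 2`.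
  have h1 : 0 < ε / 2 * (1 - r) := by nlinarith
  obtain ⟨K, hK⟩ := eventually_atTop.1 (hc.eventually (gt_mem_nhds h1))
  have h2 : ∀ j, u (K + j) ≤ r ^ j * u K + ε / 2 := fun j => by
    induction j with
    | zero => simp; linarith
    | succ j ih =>
      have h3 := h (K + j)
      have h4 := hK (K + j) (by omega)
      have h5 := mul_le_mul_of_nonneg_left ih hr0
      rw [← add_assoc, pow_succ']
      nlinarith
  have h6 : Tendsto (fun j => r ^ j * u K) atTop (𝓝 0) := by
    simpa using (tendsto_pow_atTop_nhds_zero_of_lt_one hr0 hr1).mul_const (u K)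
  obtain ⟨J, hJ⟩ := eventually_atTop.1 (h6.eventually (gt_mem_nhds (half_pos hε)))
  refine ⟨K + J, fun k hk => ?_⟩
  obtain ⟨j, rfl⟩ := Nat.exists_eq_add_of_le hk
  have h7 := h2 (J + j)
  have h8 := hJ (J + j) (by omega)
  rw [Real.dist_0_eq_abs, abs_of_nonneg (hu _), add_assoc]
  linarith

theorem le_of_le_mul_add {u : ℕ → ℝ} {r c : ℝ} (hu : ∀ k, 0 ≤ u k) (hr0 : 0 ≤ r) (hr1 : r < 1)
    (h : ∀ k, u (k + 1) ≤ r * u k + c) (hc : 0 ≤ c) (k : ℕ) : u k ≤ u 0 + c / (1 - r) := by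
  have h1 : 0 < 1 - r := by linarith
  have h2 : c / (1 - r) * (1 - r) = c := by field_simp
  have h3 : 0 ≤ c / (1 - r) := by positivity
  induction k with
  | zero => linarith
  | succ k ih =>
    have h4 := mul_le_mul_of_nonneg_left ih hr0
    nlinarith [h k, hu 0]

/-- Under a product measure, what depends on the coordinates before `k` only is independent of the
coordinate `k`. -/
theorem indepFun_eval_of_dependsOn {X Y : Type*} [MeasurableSpace X] [MeasurableSpace Y]
    [Nonempty X] (η : Measure X) [IsProbabilityMeasure η] {k : ℕ} {f : (ℕ → X) → Y}
    (hf : Measurable f) (h : DependsOn f (Set.Iio k)) :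
    IndepFun f (fun u => u k) (Measure.infinitePi fun _ : ℕ => η) := by
  have hind : iIndepFun (fun (i : ℕ) (u : ℕ → X) => u i) (Measure.infinitePi fun _ : ℕ => η) :=
    iIndepFun_infinitePi (X := fun _ x => x) fun _ => measurable_id
  have h1 := hind.indepFun_finset (Finset.range k) {k}
    (by simp) fun i => measurable_pi_apply i
  let x0 : X := Classical.arbitrary X
  -- Filling the other coordinates with an arbitrary value makes `f` factor through the coordinates
  -- below `k`, so that independence of finite blocks applies.
  let ext : ((i : Finset.range k) → X) → ℕ → X := fun v i =>
    if hi : i ∈ Finset.range k then v ⟨i, hi⟩ else x0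
  have hext : Measurable ext := by
    refine measurable_pi_lambda _ fun i => ?_
    by_cases hi : i ∈ Finset.range k
    · simp only [ext, hi, dite_true]; exact measurable_pi_apply _
    · simp only [ext, hi, dite_false]; exact measurable_const
  have h2 := h1.comp (φ := f ∘ ext)
    (ψ := fun v : ({k} : Finset ℕ) → X => v ⟨k, Finset.mem_singleton_self k⟩)
    (hf.comp hext) (measurable_pi_apply (X := fun _ : ({k} : Finset ℕ) => X) _)
  have h3 : f = (f ∘ ext) ∘ fun u i => u i := by
    ext u
    refine h fun i hi => ?_
    have hi' : i ∈ Finset.range k := Finset.mem_range.2 hi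
    change u i = if hi : i ∈ Finset.range k then u i else x0
    rw [dif_pos hi']
  rw [h3]
  exact h2

end StrongLaw

/-! ### Stable linear systems and quadratic Lyapunov functions. -/

section LinearState

open Matrix

set_option linter.unusedSectionVars false

variable {ι κ : Type*} [Fintype ι] [DecidableEq ι] [Fintype κ]

/-- The trajectory of `x⁺ = A x + B u`. -/
def linearState (A : Matrix ι ι ℝ) (B : Matrix ι κ ℝ) (x : ι → ℝ) (u : ℕ → κ → ℝ) :
    ℕ → ι → ℝ
  | 0 => x
  | k + 1 => A *ᵥ linearState A B x u k + B *ᵥ u k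

theorem dotProduct_mulVec_le (M : Matrix ι ι ℝ) (x : ι → ℝ) :
    |x ⬝ᵥ M *ᵥ x| ≤ (∑ i, ∑ j, |M i j|) * (x ⬝ᵥ x) := by
  have hx : ∀ i, x i ^ 2 ≤ x ⬝ᵥ x := fun i => by
    rw [dotProduct, sq]
    exact Finset.single_le_sum (f := fun i => x i * x i) (fun j _ => mul_self_nonneg _)
      (Finset.mem_univ i)
  generalize x ⬝ᵥ x = q at hx ⊢
  simp only [dotProduct, mulVec, Finset.mul_sum, Finset.sum_mul]
  refine (Finset.abs_sum_le_sum_abs _ _).trans (Finset.sum_le_sum fun i _ => ?_)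
  refine (Finset.abs_sum_le_sum_abs _ _).trans (Finset.sum_le_sum fun j _ => ?_)
  rw [abs_mul, abs_mul, mul_left_comm]
  refine mul_le_mul_of_nonneg_left ?_ (abs_nonneg _)
  have h1 := hx i
  have h2 := hx j
  nlinarith [sq_nonneg (|x i| - |x j|), sq_abs (x i), sq_abs (x j)]

theorem dotProduct_mulVec_conj {μ : Type*} [Fintype μ] (X : Matrix ι ι ℝ) (A : Matrix ι κ ℝ)
    (B : Matrix ι μ ℝ) (x : κ → ℝ) (y : μ → ℝ) :
    (A *ᵥ x) ⬝ᵥ X *ᵥ (B *ᵥ y) = x ⬝ᵥ (Aᵀ * X * B) *ᵥ y := by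
  rw [Matrix.mul_assoc, ← mulVec_mulVec, ← mulVec_mulVec, dotProduct_mulVec x, vecMul_transpose]

/-- A stable linear system has a quadratic Lyapunov function. -/
theorem exists_lyapunov_function {A : Matrix ι ι ℝ}
    (hA : Tendsto (fun k : ℕ => A ^ k) atTop (𝓝 0)) :
    ∃ (X : Matrix ι ι ℝ) (r C : ℝ), 0 ≤ r ∧ r < 1 ∧ 0 ≤ C ∧ (∀ x, x ⬝ᵥ x ≤ x ⬝ᵥ X *ᵥ x) ∧
      ∀ x y, (A *ᵥ x + y) ⬝ᵥ X *ᵥ (A *ᵥ x + y) ≤ r * (x ⬝ᵥ X *ᵥ x) + C * (y ⬝ᵥ y) := by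
  obtain ⟨X, hX, -⟩ := existsUnique_lyapunov (tendsto_transpose_pow hA) (1 : Matrix ι ι ℝ)
  rw [transpose_transpose] at hX
  have hXp : X.PosSemidef := lyapunov_posSemidef (tendsto_transpose_pow hA) PosSemidef.one
    (by rw [transpose_transpose]; exact hX)
  have hnn : ∀ x, 0 ≤ x ⬝ᵥ X *ᵥ x := fun x => by simpa using hXp.dotProduct_mulVec_nonneg x
  have hsymm : ∀ x y, y ⬝ᵥ X *ᵥ x = x ⬝ᵥ X *ᵥ y := fun x y => by
    have : Xᴴ = X := hXp.isHermitian
    rw [conjTranspose_eq_transpose_of_trivial] at this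
    rw [dotProduct_comm, ← vecMul_transpose, this, ← dotProduct_mulVec]
  have hVA : ∀ x, (A *ᵥ x) ⬝ᵥ X *ᵥ (A *ᵥ x) = x ⬝ᵥ X *ᵥ x - x ⬝ᵥ x := fun x => by
    rw [dotProduct_mulVec_conj]
    conv_rhs => rw [hX, add_mulVec, dotProduct_add, one_mulVec]
    ring
  have hsq : ∀ x : ι → ℝ, 0 ≤ x ⬝ᵥ x := fun x => by simpa using dotProduct_star_self_nonneg x
  set c := ∑ i, ∑ j, |X i j| with hc
  have hc0 : 0 ≤ c := by positivity
  have hle : ∀ x, x ⬝ᵥ X *ᵥ x ≤ (c + 1) * (x ⬝ᵥ x) := fun x => by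
    have := (abs_le.1 (dotProduct_mulVec_le X x)).2
    nlinarith [hsq x]
  -- As the quadratic form is at most `(c + 1) * ‖x‖²`, its decrease by `‖x‖²` along `A` is a
  -- contraction by `1 - η`. Young's inequality with weight `η` then costs a factor `1 + η`, leaving
  -- the rate `1 - η²`.
  set η := (c + 1)⁻¹ with hη
  have hη0 : 0 < η := by positivity
  have hη1 : η ≤ 1 := inv_le_one_of_one_le₀ (by linarith)
  have hηc : η * (c + 1) = 1 := by rw [hη]; field_simp
  have hVA' : ∀ x, (A *ᵥ x) ⬝ᵥ X *ᵥ (A *ᵥ x) ≤ (1 - η) * (x ⬝ᵥ X *ᵥ x) := fun x => by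
    rw [hVA]
    have h := mul_le_mul_of_nonneg_left (hle x) hη0.le
    rw [← mul_assoc, hηc, one_mul] at h
    linarith
  have hadd : ∀ x y, (x + y) ⬝ᵥ X *ᵥ (x + y) ≤
      (1 + η) * (x ⬝ᵥ X *ᵥ x) + (1 + (c + 1)) * (y ⬝ᵥ X *ᵥ y) := fun x y => by
    have h1 := hnn (η • x - y)
    simp only [mulVec_sub, mulVec_add, mulVec_smul, dotProduct_sub, sub_dotProduct, smul_dotProduct,
      dotProduct_smul, smul_eq_mul, dotProduct_add, add_dotProduct, hsymm x y] at h1 ⊢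
    have h2 := mul_nonneg (by linarith : (0 : ℝ) ≤ c + 1) h1
    have h3 : (c + 1) * (η * (η * (x ⬝ᵥ X *ᵥ x) - x ⬝ᵥ X *ᵥ y) -
        (η * (x ⬝ᵥ X *ᵥ y) - y ⬝ᵥ X *ᵥ y)) =
        (η * (c + 1)) * (η * (x ⬝ᵥ X *ᵥ x)) - 2 * (η * (c + 1)) * (x ⬝ᵥ X *ᵥ y)
          + (c + 1) * (y ⬝ᵥ X *ᵥ y) := by ring
    rw [hηc] at h3
    nlinarith
  refine ⟨X, (1 + η) * (1 - η), (1 + (c + 1)) * (c + 1), by nlinarith, by nlinarith,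
    by positivity, fun x => ?_, fun x y => ?_⟩
  · have := hnn (A *ᵥ x)
    rw [hVA] at this
    linarith
  · refine (hadd _ _).trans ?_
    have h1 := mul_le_mul_of_nonneg_left (hVA' x) (by linarith : 0 ≤ 1 + η)
    have h2 := mul_le_mul_of_nonneg_left (hle y) (by linarith : 0 ≤ 1 + (c + 1))
    linarith

theorem linearState_congr (A : Matrix ι ι ℝ) (B : Matrix ι κ ℝ) (x : ι → ℝ) (k : ℕ) :
    DependsOn (fun u : ℕ → κ → ℝ => linearState A B x u k) (Set.Iio k) := by
  intro u v h
  induction k with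
  | zero => rfl
  | succ k ih =>
    have h1 := ih fun i hi => h i (Set.mem_Iio.2 (Nat.lt_succ_of_lt hi))
    simp only [linearState] at h1 ⊢
    rw [h1, h k (Set.mem_Iio.2 k.lt_succ_self)]

theorem measurable_linearState (A : Matrix ι ι ℝ) (B : Matrix ι κ ℝ) (x : ι → ℝ) (k : ℕ) :
    Measurable (fun u : ℕ → κ → ℝ => linearState A B x u k) := by
  induction k with
  | zero => exact measurable_const
  | succ k ih =>
    have h1 : Measurable fun v : ι → ℝ => A *ᵥ v :=
      (Continuous.matrix_mulVec continuous_const continuous_id).measurable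
    have h2 : Measurable fun v : κ → ℝ => B *ᵥ v :=
      (Continuous.matrix_mulVec continuous_const continuous_id).measurable
    exact (h1.comp ih).add (h2.comp (measurable_pi_apply k))

/-- The Lyapunov function divided by `k + 1` obeys a contraction whose perturbation vanishes in the
limit. -/
theorem tendsto_linearState_sq_div {A : Matrix ι ι ℝ}
    (hA : Tendsto (fun k : ℕ => A ^ k) atTop (𝓝 0)) (B : Matrix ι κ ℝ) (x : ι → ℝ)
    {u : ℕ → κ → ℝ}
    (hu : Tendsto (fun k : ℕ => ((B *ᵥ u k) ⬝ᵥ (B *ᵥ u k)) / ((k : ℝ) + 1)) atTop (𝓝 0)) :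
    Tendsto (fun k : ℕ => (linearState A B x u k ⬝ᵥ linearState A B x u k) / ((k : ℝ) + 1)) atTop
      (𝓝 0) := by
  obtain ⟨X, r, C, hr0, hr1, hC, hX1, hX2⟩ := exists_lyapunov_function hA
  have hsq : ∀ x : ι → ℝ, 0 ≤ x ⬝ᵥ x := fun x => by simpa using dotProduct_star_self_nonneg x
  set s := linearState A B x u
  have h1 : Tendsto (fun k : ℕ => (s k ⬝ᵥ X *ᵥ s k) / ((k : ℝ) + 1)) atTop (𝓝 0) := by
    refine tendsto_zero_of_le_mul_add (r := r)
      (c := fun k => C * (((B *ᵥ u k) ⬝ᵥ (B *ᵥ u k)) / ((k : ℝ) + 1))) (fun k => ?_) hr0 hr1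
      (fun k => ?_) (by simpa using hu.const_mul C)
    · have := (hsq _).trans (hX1 (s k))
      positivity
    · have h2 := hX2 (s k) (B *ᵥ u k)
      have h3 : s (k + 1) = A *ᵥ s k + B *ᵥ u k := rfl
      rw [← h3] at h2
      have h4 := (hsq _).trans (hX1 (s (k + 1)))
      calc _ ≤ (s (k + 1) ⬝ᵥ X *ᵥ s (k + 1)) / ((k : ℝ) + 1) := by
            push_cast; gcongr; linarith
        _ ≤ (r * (s k ⬝ᵥ X *ᵥ s k) + C * ((B *ᵥ u k) ⬝ᵥ (B *ᵥ u k))) / ((k : ℝ) + 1) := by gcongr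
        _ = _ := by ring
  refine squeeze_zero (fun k => ?_) (fun k => ?_) h1
  · have := hsq (s k); positivity
  · have := hX1 (s k); gcongr

end LinearState

/-! ### Almost sure time averages under white noise. -/

section ErgodicAverages

open Matrix

set_option linter.unusedSectionVars false

variable {ι κ : Type*} [Fintype ι] [DecidableEq ι] [Fintype κ] [DecidableEq κ]
  {η : Measure (κ → ℝ)} [IsProbabilityMeasure η]

theorem memLp_eval_eval (hη : ∀ j, MemLp (fun x : κ → ℝ => x j) 2 η) (k : ℕ) (j : κ) :
    MemLp (fun u : ℕ → κ → ℝ => u k j) 2 (Measure.infinitePi fun _ : ℕ => η) :=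
  (hη j).comp_measurePreserving (measurePreserving_eval_infinitePi (fun _ : ℕ => η) k)

theorem integral_eval_infinitePi {f : (κ → ℝ) → ℝ} (hf : AEStronglyMeasurable f η) (k : ℕ) :
    ∫ u, f (u k) ∂(Measure.infinitePi fun _ : ℕ => η) = ∫ x, f x ∂η := by
  have h := measurePreserving_eval_infinitePi (fun _ : ℕ => η) k
  have h1 := h.map_eq
  rw [← h1] at hf
  conv_rhs => rw [← h1]
  exact (integral_map h.measurable.aemeasurable hf).symm

theorem memLp_linearState (hη : ∀ j, MemLp (fun x : κ → ℝ => x j) 2 η) (A : Matrix ι ι ℝ)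
    (B : Matrix ι κ ℝ) (x : ι → ℝ) (k : ℕ) (i : ι) :
    MemLp (fun u : ℕ → κ → ℝ => linearState A B x u k i) 2
      (Measure.infinitePi fun _ : ℕ => η) := by
  induction k generalizing i with
  | zero => exact memLp_const _
  | succ k ih =>
    exact (memLp_finsetSum _ fun j _ => (ih j).const_mul (A i j)).add
      (memLp_finsetSum _ fun j _ => (memLp_eval_eval hη k j).const_mul (B i j))

theorem integrable_dotProduct_mulVec {Ω μ : Type*} [MeasurableSpace Ω] [Fintype μ] {ν : Measure Ω}
    {f : Ω → ι → ℝ} {g : Ω → μ → ℝ} (hf : ∀ i, MemLp (fun ω => f ω i) 2 ν)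
    (hg : ∀ i, MemLp (fun ω => g ω i) 2 ν) (M : Matrix ι μ ℝ) :
    Integrable (fun ω => f ω ⬝ᵥ M *ᵥ g ω) ν := by
  refine integrable_finsetSum _ fun i _ => (hf i).integrable_mul (p := 2) (q := 2) ?_
  exact memLp_finsetSum _ fun j _ => (hg j).const_mul (M i j)

/-- Second moments of a stable system driven by white noise are bounded. -/
theorem exists_integral_linearState_le (hη : ∀ j, MemLp (fun x : κ → ℝ => x j) 2 η)
    {A : Matrix ι ι ℝ} (hA : Tendsto (fun k : ℕ => A ^ k) atTop (𝓝 0)) (B : Matrix ι κ ℝ)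
    (x : ι → ℝ) : ∃ c : ℝ, ∀ k, ∫ u, linearState A B x u k ⬝ᵥ linearState A B x u k
      ∂(Measure.infinitePi fun _ : ℕ => η) ≤ c := by
  obtain ⟨X, r, C, hr0, hr1, hC, hX1, hX2⟩ := exists_lyapunov_function hA
  have hsq : ∀ x : ι → ℝ, 0 ≤ x ⬝ᵥ x := fun x => by simpa using dotProduct_star_self_nonneg x
  set P := Measure.infinitePi fun _ : ℕ => η
  have hL := memLp_linearState hη A B x
  have hi1 := fun k => integrable_dotProduct_mulVec (hL k) (hL k) X
  have hi2 : ∀ k, Integrable (fun u => linearState A B x u k ⬝ᵥ linearState A B x u k) P :=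
    fun k => by simpa using integrable_dotProduct_mulVec (hL k) (hL k) 1
  have hB : ∀ i, MemLp (fun v : κ → ℝ => (B *ᵥ v) i) 2 η := fun i =>
    memLp_finsetSum _ fun j _ => (hη j).const_mul (B i j)
  have hi0 : Integrable (fun v : κ → ℝ => (B *ᵥ v) ⬝ᵥ (B *ᵥ v)) η := by
    simpa using integrable_dotProduct_mulVec hB hB 1
  have hi3 : ∀ k, Integrable (fun u : ℕ → κ → ℝ => (B *ᵥ u k) ⬝ᵥ (B *ᵥ u k)) P := fun k =>
    (measurePreserving_eval_infinitePi (fun _ : ℕ => η) k).integrable_comp_of_integrable hi0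
  have hrec : ∀ k, ∫ u, linearState A B x u (k + 1) ⬝ᵥ X *ᵥ linearState A B x u (k + 1) ∂P ≤
      r * ∫ u, linearState A B x u k ⬝ᵥ X *ᵥ linearState A B x u k ∂P +
        C * ∫ v, (B *ᵥ v) ⬝ᵥ (B *ᵥ v) ∂η := fun k => by
    rw [← integral_eval_infinitePi hi0.aestronglyMeasurable k, ← integral_const_mul,
      ← integral_const_mul, ← integral_add ((hi1 k).const_mul r) ((hi3 k).const_mul C)]
    exact integral_mono (hi1 _) (((hi1 k).const_mul r).add ((hi3 k).const_mul C))
      fun u => hX2 _ _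
  refine ⟨_, fun k => (integral_mono (hi2 k) (hi1 k) fun u => hX1 _).trans
    (le_of_le_mul_add
      (u := fun k => ∫ u, linearState A B x u k ⬝ᵥ X *ᵥ linearState A B x u k ∂P)
      (fun k => integral_nonneg fun u => (hsq _).trans (hX1 _)) hr0 hr1 hrec ?_ k)⟩
  exact mul_nonneg hC (integral_nonneg fun v => hsq _)

/-- The average of the correlations of the state with the fresh noise vanishes. -/
theorem ae_tendsto_average_cross (hη : ∀ j, MemLp (fun x : κ → ℝ => x j) 2 η)
    (h0 : ∀ j, ∫ x, x j ∂η = 0) {A : Matrix ι ι ℝ}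
    (hA : Tendsto (fun k : ℕ => A ^ k) atTop (𝓝 0)) (B : Matrix ι κ ℝ) (x : ι → ℝ)
    (Y : Matrix ι κ ℝ) :
    ∀ᵐ u ∂(Measure.infinitePi fun _ : ℕ => η), Tendsto (fun T : ℕ =>
      (∑ k ∈ Finset.range T, linearState A B x u k ⬝ᵥ Y *ᵥ u k) / T) atTop (𝓝 0) := by
  set P := Measure.infinitePi fun _ : ℕ => η
  let f : ℕ → κ → (ℕ → κ → ℝ) → ℝ := fun k j u => (Yᵀ *ᵥ linearState A B x u k) j
  have hD : ∀ k u, linearState A B x u k ⬝ᵥ Y *ᵥ u k = ∑ j, f k j u * u k j := fun k u => by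
    rw [dotProduct_mulVec, ← mulVec_transpose]; rfl
  have hmeas : ∀ k, Measurable fun u => Yᵀ *ᵥ linearState A B x u k := fun k =>
    (Continuous.matrix_mulVec continuous_const continuous_id).measurable.comp
      (measurable_linearState A B x k)
  have hdep : ∀ k, DependsOn (fun u => Yᵀ *ᵥ linearState A B x u k) (Set.Iio k) := fun k u v h => by
    have := linearState_congr A B x k h
    simp only at this ⊢
    rw [this]
  have hf : ∀ k j, MemLp (f k j) 2 P := fun k j =>
    memLp_finsetSum _ fun i _ => (memLp_linearState hη A B x k i).const_mul (Yᵀ j i)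
  have hind : ∀ k, IndepFun (fun u => Yᵀ *ᵥ linearState A B x u k) (fun u => u k) P := fun k =>
    indepFun_eval_of_dependsOn η (hmeas k) (hdep k)
  have hfu : ∀ k j, MemLp (fun u => f k j u * u k j) 2 P := fun k j => by
    have h1 : IndepFun (fun u => f k j u ^ 2) (fun u : ℕ → κ → ℝ => u k j ^ 2) P :=
      (hind k).comp (φ := fun v : κ → ℝ => v j ^ 2) (ψ := fun v : κ → ℝ => v j ^ 2)
        (by fun_prop) (by fun_prop)
    have h2 := h1.integrable_mul (hf k j).integrable_sq (memLp_eval_eval hη k j).integrable_sq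
    refine (memLp_two_iff_integrable_sq
      ((hf k j).aestronglyMeasurable.mul (memLp_eval_eval hη k j).aestronglyMeasurable)).2 ?_
    refine h2.congr (Eventually.of_forall fun u => ?_)
    simp [mul_pow]
  obtain ⟨c, hc⟩ := exists_integral_linearState_le hη hA B x
  set y := ∑ i, ∑ j, |(Y * Yᵀ) i j|
  have hsq : ∀ (κ : Type _) [Fintype κ] (x : κ → ℝ), 0 ≤ x ⬝ᵥ x := fun _ _ x => by
    simpa using dotProduct_star_self_nonneg x
  have hL := memLp_linearState hη A B x
  have hi2 : ∀ k, Integrable (fun u => linearState A B x u k ⬝ᵥ linearState A B x u k) P :=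
    fun k => by simpa using integrable_dotProduct_mulVec (hL k) (hL k) 1
  have hDk : ∀ k, MemLp (fun u => linearState A B x u k ⬝ᵥ Y *ᵥ u k) 2 P := fun k => by
    simp_rw [hD]
    exact memLp_finsetSum _ fun j _ => hfu k j
  refine ae_tendsto_average_of_uncorrelated (C := y * c * ∫ v : κ → ℝ, v ⬝ᵥ v ∂η) hDk
    (fun k => ?_) fun k l hlk => ?_
  · let F : (κ → ℝ) → ℝ := fun v => v ⬝ᵥ v
    have hFm : Measurable F := by fun_prop
    have h1 : IndepFun (fun u => F (Yᵀ *ᵥ linearState A B x u k))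
        (fun u : ℕ → κ → ℝ => F (u k)) P := (hind k).comp hFm hFm
    have hF1 : Integrable (fun u => F (Yᵀ *ᵥ linearState A B x u k)) P := by
      have := integrable_dotProduct_mulVec (fun j => hf k j) (fun j => hf k j) 1
      simpa using this
    have hF2 : Integrable (fun u : ℕ → κ → ℝ => F (u k)) P := by
      have := integrable_dotProduct_mulVec (fun j => memLp_eval_eval hη k j)
        (fun j => memLp_eval_eval hη k j) 1
      simpa using this
    -- Cauchy-Schwarz separates the state from the fresh noise. Independence then factors the second
    -- moment, which is bounded uniformly in `k` by stability.
    have hle : ∀ u, (linearState A B x u k ⬝ᵥ Y *ᵥ u k) ^ 2 ≤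
        F (Yᵀ *ᵥ linearState A B x u k) * F (u k) := fun u => by
      rw [hD]
      simpa [F, dotProduct, sq] using Finset.sum_mul_sq_le_sq_mul_sq Finset.univ
        (fun j => f k j u) fun j => u k j
    have hle2 : ∀ u, F (Yᵀ *ᵥ linearState A B x u k) ≤
        y * (linearState A B x u k ⬝ᵥ linearState A B x u k) := fun u => by
      have h2 := dotProduct_mulVec_conj (1 : Matrix κ κ ℝ) Yᵀ Yᵀ (linearState A B x u k)
        (linearState A B x u k)
      rw [one_mulVec, transpose_transpose, Matrix.mul_one] at h2
      change (Yᵀ *ᵥ linearState A B x u k) ⬝ᵥ (Yᵀ *ᵥ linearState A B x u k) ≤ _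
      rw [h2]
      exact (abs_le.1 (dotProduct_mulVec_le _ _)).2
    refine (integral_mono (hDk k).integrable_sq (h1.integrable_mul hF1 hF2) hle).trans ?_
    have h3 := h1.integral_fun_mul_eq_mul_integral hF1.aestronglyMeasurable
      hF2.aestronglyMeasurable
    change ∫ u, F (Yᵀ *ᵥ linearState A B x u k) * F (u k) ∂P ≤ _
    rw [h3, integral_eval_infinitePi hFm.aestronglyMeasurable]
    refine mul_le_mul_of_nonneg_right ?_ (integral_nonneg fun v => hsq _ _)
    refine (integral_mono hF1 ((hi2 k).const_mul y) hle2).trans ?_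
    rw [integral_const_mul]
    exact mul_le_mul_of_nonneg_left (hc k) (by positivity)
  -- Orthogonality: for `l < k`, everything but the factor `u k j` depends on earlier inputs only,
  -- and `u k j` is centered.
  · have h1 : ∀ u, (linearState A B x u l ⬝ᵥ Y *ᵥ u l) * (linearState A B x u k ⬝ᵥ Y *ᵥ u k) =
        ∑ j, ((linearState A B x u l ⬝ᵥ Y *ᵥ u l) * f k j u) * u k j := fun u => by
      rw [hD k, Finset.mul_sum]
      exact Finset.sum_congr rfl fun j _ => (mul_assoc _ _ _).symm
    have hmD : Measurable fun u : ℕ → κ → ℝ => linearState A B x u l ⬝ᵥ Y *ᵥ u l := by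
      have h2 : Continuous fun p : (ι → ℝ) × (κ → ℝ) => p.1 ⬝ᵥ Y *ᵥ p.2 := by fun_prop
      exact h2.measurable.comp ((measurable_linearState A B x l).prodMk (measurable_pi_apply l))
    have hmf : ∀ j, Measurable (f k j) := fun j => (measurable_pi_apply j).comp (hmeas k)
    have hindj : ∀ j, IndepFun (fun u => (linearState A B x u l ⬝ᵥ Y *ᵥ u l) * f k j u)
        (fun u : ℕ → κ → ℝ => u k j) P := fun j => by
      refine (indepFun_eval_of_dependsOn η (hmD.mul (hmf j)) fun u v h => ?_).comp
        (φ := id) (ψ := fun v : κ → ℝ => v j) measurable_id (by fun_prop)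
      have h2 := linearState_congr A B x l fun i hi => h i ((Set.mem_Iio.1 hi).trans hlk)
      have h3 := hdep k h
      have h4 := h l hlk
      simp only [Pi.mul_apply, f] at h2 h3 ⊢
      rw [h2, h3, h4]
    simp_rw [h1]
    rw [integral_finsetSum]
    · refine Finset.sum_eq_zero fun j _ => ?_
      rw [(hindj j).integral_fun_mul_eq_mul_integral (hmD.mul (hmf j)).aestronglyMeasurable
        (memLp_eval_eval hη k j).aestronglyMeasurable,
        integral_eval_infinitePi (f := fun v => v j) (hη j).aestronglyMeasurable, h0, mul_zero]
    · exact fun j _ => (hindj j).integrable_mul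
        ((hDk l).integrable_mul (p := 2) (q := 2) (hf k j))
        ((memLp_eval_eval hη k j).integrable (by norm_num))

/-- Strong law of large numbers for the i.i.d. integrable variables `u k ⬝ᵥ N *ᵥ u k`. -/
theorem ae_tendsto_average_noise (hη : ∀ j, MemLp (fun x : κ → ℝ => x j) 2 η)
    {W : Matrix κ κ ℝ} (hW : ∀ i j, ∫ x, x i * x j ∂η = W i j) (N : Matrix κ κ ℝ) :
    ∀ᵐ u ∂(Measure.infinitePi fun _ : ℕ => η), Tendsto (fun T : ℕ =>
      (∑ k ∈ Finset.range T, u k ⬝ᵥ N *ᵥ u k) / T) atTop (𝓝 (N * W).trace) := by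
  have hf : Measurable fun v : κ → ℝ => v ⬝ᵥ N *ᵥ v := by
    have : Continuous fun v : κ → ℝ => v ⬝ᵥ N *ᵥ v := by fun_prop
    exact this.measurable
  have hmp := measurePreserving_eval_infinitePi (fun _ : ℕ => η)
  have hi : Integrable (fun v : κ → ℝ => v ⬝ᵥ N *ᵥ v) η := by
    exact integrable_dotProduct_mulVec hη hη N
  have h := strong_law_ae_real (fun k (u : ℕ → κ → ℝ) => u k ⬝ᵥ N *ᵥ u k)
    ((hmp 0).integrable_comp_of_integrable hi)
    (fun i j hij => (iIndepFun_infinitePi (X := fun _ v => v ⬝ᵥ N *ᵥ v) fun _ => hf).indepFun hij)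
    fun i => IdentDistrib.comp (u := fun v : κ → ℝ => v ⬝ᵥ N *ᵥ v)
      ⟨(hmp i).measurable.aemeasurable, (hmp 0).measurable.aemeasurable,
        (hmp i).map_eq.trans (hmp 0).map_eq.symm⟩ hf
  rw [integral_eval_infinitePi hf.aestronglyMeasurable] at h
  have hint : ∫ v, v ⬝ᵥ N *ᵥ v ∂η = (N * W).trace := by
    have h1 : ∀ v : κ → ℝ, v ⬝ᵥ N *ᵥ v = ∑ i, ∑ j, N i j * (v j * v i) := fun v => by
      simp only [dotProduct, mulVec, Finset.mul_sum]
      exact Finset.sum_congr rfl fun i _ => Finset.sum_congr rfl fun j _ => by ring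
    have h2 : ∀ i j, Integrable (fun v : κ → ℝ => N i j * (v j * v i)) η := fun i j =>
      ((hη j).integrable_mul (hη i)).const_mul _
    simp_rw [h1]
    rw [integral_finsetSum _ fun i _ => integrable_finsetSum _ fun j _ => h2 i j, trace]
    refine Finset.sum_congr rfl fun i _ => ?_
    rw [integral_finsetSum _ fun j _ => h2 i j, diag_apply, mul_apply]
    refine Finset.sum_congr rfl fun j _ => ?_
    rw [integral_const_mul, hW]
  rwa [hint] at h

/-- The time averages of a quadratic form of a stable system driven by white noise converge to the
stationary mean. -/
theorem ae_tendsto_average_quadratic (hη : ∀ j, MemLp (fun x : κ → ℝ => x j) 2 η)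
    (h0 : ∀ j, ∫ x, x j ∂η = 0) {W : Matrix κ κ ℝ} (hW : ∀ i j, ∫ x, x i * x j ∂η = W i j)
    {A : Matrix ι ι ℝ} (hA : Tendsto (fun k : ℕ => A ^ k) atTop (𝓝 0)) {B : Matrix ι κ ℝ}
    {S : Matrix ι ι ℝ} (hS : S = A * S * Aᵀ + B * W * Bᵀ) (x : ι → ℝ) (M : Matrix ι ι ℝ) :
    ∀ᵐ u ∂(Measure.infinitePi fun _ : ℕ => η), Tendsto (fun T : ℕ =>
      (∑ k ∈ Finset.range T, linearState A B x u k ⬝ᵥ M *ᵥ linearState A B x u k) / T) atTop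
      (𝓝 (M * S).trace) := by
  -- The dual equation `X = Aᵀ X A + M` makes the form of `M` along the trajectory a telescoping
  -- difference plus a cross term and a pure noise term.
  obtain ⟨X, hX, -⟩ := existsUnique_lyapunov (tendsto_transpose_pow hA) M
  rw [transpose_transpose] at hX
  -- Duality: expand `tr (X S)` once by the equation of `X` and once by that of `S`.
  have htr : (Bᵀ * X * B * W).trace = (M * S).trace := by
    have h1 : (X * S).trace = (Aᵀ * X * A * S).trace + (M * S).trace := by
      rw [← trace_add, ← Matrix.add_mul, ← hX]
    have h2 : (X * S).trace = (X * (A * S * Aᵀ)).trace + (X * (B * W * Bᵀ)).trace := by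
      rw [← trace_add, ← Matrix.mul_add, ← hS]
    have h3 : (X * (A * S * Aᵀ)).trace = (Aᵀ * X * A * S).trace := by
      rw [← Matrix.mul_assoc, trace_mul_comm]; simp only [Matrix.mul_assoc]
    have h4 : (X * (B * W * Bᵀ)).trace = (Bᵀ * X * B * W).trace := by
      rw [← Matrix.mul_assoc, trace_mul_comm]; simp only [Matrix.mul_assoc]
    linarith
  filter_upwards [ae_tendsto_average_cross hη h0 hA B x (Aᵀ * X * B + Aᵀ * Xᵀ * B),
    ae_tendsto_average_noise hη hW (Bᵀ * X * B), ae_tendsto_average_noise hη hW (Bᵀ * B)]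
    with u hu1 hu2 hu3
  set s := linearState A B x u
  have hBB : ∀ k, (B *ᵥ u k) ⬝ᵥ (B *ᵥ u k) = u k ⬝ᵥ (Bᵀ * B) *ᵥ u k := fun k => by
    have := dotProduct_mulVec_conj (1 : Matrix ι ι ℝ) B B (u k) (u k)
    rwa [one_mulVec, Matrix.mul_one] at this
  -- A single term over `k + 1` is the average of `k + 1` terms minus `k / (k + 1)` times the
  -- average of `k` terms.
  have hBu : Tendsto (fun k : ℕ => ((B *ᵥ u k) ⬝ᵥ (B *ᵥ u k)) / ((k : ℝ) + 1)) atTop (𝓝 0) := by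
    have h1 : Tendsto (fun k : ℕ => (k : ℝ) / (k + 1)) atTop (𝓝 1) :=
      tendsto_natCast_div_add_atTop 1
    have h2 := ((tendsto_add_atTop_iff_nat 1).2 hu3).sub (hu3.mul h1)
    rw [mul_one, sub_self] at h2
    refine h2.congr fun k => ?_
    rw [hBB, Finset.sum_range_succ]
    rcases Nat.eq_zero_or_pos k with rfl | hk
    · simp
    · push_cast
      field_simp
      ring
  have hend : Tendsto (fun T : ℕ => (s T ⬝ᵥ X *ᵥ s T) / T) atTop (𝓝 0) := by
    have h1 := (tendsto_linearState_sq_div hA B x hBu).const_mul (2 * ∑ i, ∑ j, |X i j|)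
    rw [mul_zero] at h1
    refine squeeze_zero_norm' ?_ h1
    filter_upwards [eventually_ge_atTop 1] with T hT
    have hT' : (1 : ℝ) ≤ T := by exact_mod_cast hT
    have hsq : 0 ≤ s T ⬝ᵥ s T := by simpa using dotProduct_star_self_nonneg (s T)
    rw [norm_div, Real.norm_eq_abs, Real.norm_of_nonneg (by positivity), ← mul_div_assoc,
      div_le_div_iff₀ (by positivity) (by positivity)]
    have h2 := dotProduct_mulVec_le X (s T)
    have h3 := abs_nonneg (s T ⬝ᵥ X *ᵥ s T)
    calc _ ≤ |s T ⬝ᵥ X *ᵥ s T| * (2 * T) := by gcongr; linarith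
      _ ≤ ((∑ i, ∑ j, |X i j|) * (s T ⬝ᵥ s T)) * (2 * T) := by gcongr
      _ = _ := by ring
  have hstart : Tendsto (fun T : ℕ => (s 0 ⬝ᵥ X *ᵥ s 0) / T) atTop (𝓝 0) :=
    tendsto_const_div_atTop_nhds_zero_nat _
  have hstep : ∀ k, s k ⬝ᵥ M *ᵥ s k = (s k ⬝ᵥ X *ᵥ s k - s (k + 1) ⬝ᵥ X *ᵥ s (k + 1)) +
      s k ⬝ᵥ (Aᵀ * X * B + Aᵀ * Xᵀ * B) *ᵥ u k + u k ⬝ᵥ (Bᵀ * X * B) *ᵥ u k := fun k => by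
    have h1 : s (k + 1) = A *ᵥ s k + B *ᵥ u k := rfl
    have h2 : (B *ᵥ u k) ⬝ᵥ X *ᵥ (A *ᵥ s k) = s k ⬝ᵥ (Aᵀ * Xᵀ * B) *ᵥ u k := by
      rw [dotProduct_mulVec_conj, dotProduct_comm, dotProduct_mulVec, ← mulVec_transpose]
      simp only [transpose_mul, transpose_transpose, Matrix.mul_assoc]
    have h3 : s k ⬝ᵥ X *ᵥ s k = s k ⬝ᵥ (Aᵀ * X * A) *ᵥ s k + s k ⬝ᵥ M *ᵥ s k := by
      rw [← dotProduct_add, ← add_mulVec, ← hX]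
    rw [h1]
    simp only [mulVec_add, add_mulVec, add_dotProduct, dotProduct_add, dotProduct_mulVec_conj] at h2 ⊢
    rw [h2]
    linarith
  have hfin := ((hstart.sub hend).add hu1).add hu2
  rw [sub_zero, zero_add, zero_add, htr] at hfin
  refine hfin.congr fun T => ?_
  simp_rw [hstep]
  rw [Finset.sum_add_distrib, Finset.sum_add_distrib,
    Finset.sum_range_sub' fun k => s k ⬝ᵥ X *ᵥ s k]
  ring

end ErgodicAverages

/-! ### Characteristic functions and moments of Gaussian vectors. -/

section GaussianVectors

open Matrix

instance isProbabilityMeasure_gaussianVec {d : ℕ} (μ : Fin d → ℝ) (S : Matrix (Fin d) (Fin d) ℝ) :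
    IsProbabilityMeasure (gaussianVec μ S) :=
  Measure.isProbabilityMeasure_map (by fun_prop)

variable {d : ℕ} {S : Matrix (Fin d) (Fin d) ℝ}

theorem inner_eq_dotProduct {ι : Type*} [Fintype ι] (x y : EuclideanSpace ℝ ι) :
    inner ℝ x y = x.ofLp ⬝ᵥ y.ofLp := by
  rw [EuclideanSpace.inner_eq_star_dotProduct, star_trivial, dotProduct_comm]

theorem integral_cexp_gaussianVec (μ : Fin d → ℝ) (hS : S.PosSemidef) (a : Fin d → ℝ) :
    ∫ x, Complex.exp ((a ⬝ᵥ x : ℝ) * Complex.I) ∂gaussianVec μ S =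
      Complex.exp ((a ⬝ᵥ μ : ℝ) * Complex.I - ((a ⬝ᵥ S *ᵥ a : ℝ) : ℂ) / 2) := by
  rw [gaussianVec, integral_map (by fun_prop)
    (Continuous.aestronglyMeasurable (by fun_prop))]
  have h := charFun_multivariateGaussian (μ := WithLp.toLp 2 μ) hS (WithLp.toLp 2 a)
  rw [charFun_apply] at h
  simp only [inner_eq_dotProduct] at h
  rw [← h]
  simp only [dotProduct_comm a]

theorem memLp_two_eval_gaussianVec (μ : Fin d → ℝ) (S : Matrix (Fin d) (Fin d) ℝ) (i : Fin d) :
    MemLp (fun x => x i) 2 (gaussianVec μ S) := by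
  rw [gaussianVec, memLp_map_measure_iff
    (continuous_apply (A := fun _ : Fin d => ℝ) i).aestronglyMeasurable (by fun_prop)]
  exact memLp_two_eval_multivariateGaussian _ _ i

theorem integral_eval_gaussianVec (μ : Fin d → ℝ) (S : Matrix (Fin d) (Fin d) ℝ) (i : Fin d) :
    ∫ x, x i ∂gaussianVec μ S = μ i := by
  rw [gaussianVec, integral_map (by fun_prop)
    (continuous_apply (A := fun _ : Fin d => ℝ) i).aestronglyMeasurable]
  exact integral_eval_multivariateGaussian _ _ i

theorem integral_eval_mul_eval_gaussianVec (hS : S.PosSemidef) (i j : Fin d) :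
    ∫ x, x i * x j ∂gaussianVec 0 S = S i j := by
  rw [gaussianVec, integral_map (by fun_prop) (by fun_prop)]
  have h := covariance_eval_multivariateGaussian (μ := WithLp.toLp 2 (0 : Fin d → ℝ)) hS i j
  rw [covariance_eq_sub (memLp_two_eval_multivariateGaussian _ _ i)
    (memLp_two_eval_multivariateGaussian _ _ j), integral_eval_multivariateGaussian] at h
  simpa using h

/-- Supplies a mean and a covariance for the law of the recorded initial estimate. They are read off
in Euclidean space, where the formula for Gaussian characteristic functions applies. -/
theorem exists_integral_cexp_of_isGaussian {ν : Measure (Fin d → ℝ)} [IsGaussian ν] :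
    ∃ (m : Fin d → ℝ) (V : Matrix (Fin d) (Fin d) ℝ), V.PosSemidef ∧ ∀ a : Fin d → ℝ,
      ∫ x, Complex.exp ((a ⬝ᵥ x : ℝ) * Complex.I) ∂ν =
        Complex.exp ((a ⬝ᵥ m : ℝ) * Complex.I - ((a ⬝ᵥ V *ᵥ a : ℝ) : ℂ) / 2) := by
  let F := ((PiLp.continuousLinearEquiv 2 ℝ (fun _ : Fin d => ℝ)).symm :
    (Fin d → ℝ) →L[ℝ] EuclideanSpace ℝ (Fin d))
  set ν' := ν.map F
  let e : Fin d → EuclideanSpace ℝ (Fin d) := fun i => EuclideanSpace.basisFun (Fin d) ℝ i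
  let V : Matrix (Fin d) (Fin d) ℝ := of fun i j => covarianceBilin ν' (e i) (e j)
  have hV : ∀ a : Fin d → ℝ,
      covarianceBilin ν' (WithLp.toLp 2 a) (WithLp.toLp 2 a) = a ⬝ᵥ V *ᵥ a := fun a => by
    have ha : WithLp.toLp 2 a = ∑ i, a i • e i := by
      have := (EuclideanSpace.basisFun (Fin d) ℝ).sum_repr (WithLp.toLp 2 a)
      simpa [e] using this.symm
    rw [ha]
    simp only [map_sum, map_smul, _root_.sum_apply, _root_.smul_apply,
      smul_eq_mul, dotProduct, mulVec, V, of_apply, Finset.mul_sum]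
    rw [Finset.sum_comm]
    refine Finset.sum_congr rfl fun i _ => Finset.sum_congr rfl fun j _ => ?_
    ring
  refine ⟨(∫ x, x ∂ν').ofLp, V, PosSemidef.of_dotProduct_mulVec_nonneg ?_ fun a => ?_, fun a => ?_⟩
  · ext i j
    simp only [conjTranspose_apply, V, of_apply, star_trivial]
    exact covarianceBilin_comm _ _
  · rw [star_trivial, ← hV]
    exact covarianceBilin_self_nonneg _
  · have h := IsGaussian.charFun_eq' (μ := ν') (WithLp.toLp 2 a)
    rw [hV, charFun_apply, integral_map (by fun_prop)
      (Continuous.aestronglyMeasurable (by fun_prop))] at h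
    simp only [inner_eq_dotProduct, id_eq] at h
    rw [← h]
    simp only [dotProduct_comm a]
    rfl

/-- Induction on `T`: the last coordinate is independent of the sum over the earlier ones. -/
theorem integral_cexp_infinitePi_gaussianVec (hS : S.PosSemidef) (α : ℕ → Fin d → ℝ) (T : ℕ) :
    ∫ u, Complex.exp ((∑ j ∈ Finset.range T, α j ⬝ᵥ u j : ℝ) * Complex.I)
      ∂(Measure.infinitePi fun _ : ℕ => gaussianVec 0 S) =
      Complex.exp (-((∑ j ∈ Finset.range T, α j ⬝ᵥ S *ᵥ α j : ℝ) : ℂ) / 2) := by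
  induction T with
  | zero => simp
  | succ T ih =>
    let f : (ℕ → Fin d → ℝ) → ℂ := fun u =>
      Complex.exp ((∑ j ∈ Finset.range T, α j ⬝ᵥ u j : ℝ) * Complex.I)
    let g : (Fin d → ℝ) → ℂ := fun x => Complex.exp ((α T ⬝ᵥ x : ℝ) * Complex.I)
    have hf : Measurable f := by fun_prop
    have hg : Continuous g := by fun_prop
    have hind : IndepFun f (fun u => g (u T)) (Measure.infinitePi fun _ : ℕ => gaussianVec 0 S) := by
      refine (indepFun_eval_of_dependsOn (k := T) _ hf fun u v h => ?_).comp
        (φ := id) (ψ := g) measurable_id hg.measurable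
      have : ∑ j ∈ Finset.range T, α j ⬝ᵥ u j = ∑ j ∈ Finset.range T, α j ⬝ᵥ v j :=
        Finset.sum_congr rfl fun j hj => by rw [h j (Finset.mem_range.1 hj)]
      simp only [f, this]
    have h1 : ∀ u : ℕ → Fin d → ℝ,
        Complex.exp ((∑ j ∈ Finset.range (T + 1), α j ⬝ᵥ u j : ℝ) * Complex.I) =
          f u * g (u T) := fun u => by
      rw [Finset.sum_range_succ, Complex.ofReal_add, add_mul, Complex.exp_add]
    have hmp := measurePreserving_eval_infinitePi (fun _ : ℕ => gaussianVec 0 S) T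
    have h2 : ∫ u, g (u T) ∂(Measure.infinitePi fun _ : ℕ => gaussianVec 0 S) =
        ∫ x, g x ∂gaussianVec 0 S := by
      conv_rhs => rw [← hmp.map_eq]
      exact (integral_map hmp.measurable.aemeasurable hg.aestronglyMeasurable).symm
    simp_rw [h1]
    rw [hind.integral_fun_mul_eq_mul_integral hf.aestronglyMeasurable
      (hg.measurable.comp (measurable_pi_apply T)).aestronglyMeasurable, ih, h2,
      integral_cexp_gaussianVec 0 hS, ← Complex.exp_add, Finset.sum_range_succ]
    congr 1
    simp
    ring

end GaussianVectors

/-! ### Linear responses as functionals of the initial state and the inputs. -/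

section LinearStateAlgebra

open Matrix

set_option linter.unusedSectionVars false

variable {ι κ ν : Type*} [Fintype ι] [DecidableEq ι] [Fintype κ] [DecidableEq κ] [Fintype ν]
  [DecidableEq ν]

theorem linearState_eq (A : Matrix ι ι ℝ) (B : Matrix ι κ ℝ) (x : ι → ℝ) (u : ℕ → κ → ℝ) (k : ℕ) :
    linearState A B x u k = A ^ k *ᵥ x +
      ∑ j ∈ Finset.range k, (A ^ (k - 1 - j) * B) *ᵥ u j := by
  induction k with
  | zero => simp [linearState]
  | succ k ih =>
    rw [linearState, ih, Finset.sum_range_succ, mulVec_add, mulVec_mulVec, ← pow_succ', ← add_assoc,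
      mulVec_sum]
    congr 1
    · congr 1
      refine Finset.sum_congr rfl fun j hj => ?_
      have hj := Finset.mem_range.1 hj
      rw [mulVec_mulVec, show k + 1 - 1 - j = (k - 1 - j) + 1 by omega, pow_succ',
        Matrix.mul_assoc]
    · simp

theorem linearState_sub (A : Matrix ι ι ℝ) (B : Matrix ι κ ℝ) (x x' : ι → ℝ) (u u' : ℕ → κ → ℝ)
    (k : ℕ) : linearState A B (x - x') (fun j => u j - u' j) k =
      linearState A B x u k - linearState A B x' u' k := by
  induction k with
  | zero => rfl
  | succ k ih => rw [linearState, ih, mulVec_sub, mulVec_sub, linearState, linearState]; abel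

theorem response_eq (A : Matrix ι ι ℝ) (B : Matrix ι κ ℝ) (D : Matrix ν ι ℝ) (x : ι → ℝ)
    (u : ℕ → κ → ℝ) (T : ℕ) :
    (fun k : Fin T × ν => (D *ᵥ linearState A B x u k.1) k.2) =
      obsMatrix A D T *ᵥ x + ∑ j ∈ Finset.range T, inputMatrix A B D T j *ᵥ u j := by
  ext k
  rw [linearState_eq, mulVec_add, mulVec_mulVec, mulVec_sum, Pi.add_apply, Pi.add_apply,
    Finset.sum_apply, Finset.sum_apply]
  congr 1
  have hk := k.1.2
  rw [← Finset.sum_range_add_sum_Ico _ hk.le]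
  have h0 : ∑ j ∈ Finset.Ico (k.1 : ℕ) T, (inputMatrix A B D T j *ᵥ u j) k = 0 := by
    refine Finset.sum_eq_zero fun j hj => ?_
    have hj := (Finset.mem_Ico.1 hj).1
    simp [mulVec, inputMatrix, dotProduct, not_lt.2 hj]
  rw [h0, add_zero]
  refine Finset.sum_congr rfl fun j hj => ?_
  have hj := Finset.mem_range.1 hj
  rw [mulVec_mulVec]
  simp [mulVec, inputMatrix, hj]

theorem dotProduct_response (A : Matrix ι ι ℝ) (B : Matrix ι κ ℝ) (D : Matrix ν ι ℝ) (x : ι → ℝ)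
    (u : ℕ → κ → ℝ) (T : ℕ) (t : Fin T × ν → ℝ) :
    (t ⬝ᵥ fun k : Fin T × ν => (D *ᵥ linearState A B x u k.1) k.2) =
      ((obsMatrix A D T)ᵀ *ᵥ t) ⬝ᵥ x +
        ∑ j ∈ Finset.range T, ((inputMatrix A B D T j)ᵀ *ᵥ t) ⬝ᵥ u j := by
  rw [response_eq, dotProduct_add, dotProduct_sum, dotProduct_mulVec, mulVec_transpose]
  simp only [dotProduct_mulVec, mulVec_transpose]

theorem dotProduct_responseCov (A : Matrix ι ι ℝ) (B : Matrix ι κ ℝ) (D : Matrix ν ι ℝ)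
    (W : Matrix κ κ ℝ) (V : Matrix ι ι ℝ) (T : ℕ) (t : Fin T × ν → ℝ) :
    t ⬝ᵥ responseCov A B D W V T *ᵥ t =
      ((obsMatrix A D T)ᵀ *ᵥ t) ⬝ᵥ V *ᵥ ((obsMatrix A D T)ᵀ *ᵥ t) +
        ∑ j ∈ Finset.range T,
          ((inputMatrix A B D T j)ᵀ *ᵥ t) ⬝ᵥ W *ᵥ ((inputMatrix A B D T j)ᵀ *ᵥ t) := by
  rw [responseCov, add_mulVec, dotProduct_add, sum_mulVec, dotProduct_sum]
  simp only [dotProduct_mulVec_conj, transpose_transpose]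

end LinearStateAlgebra

variable {n p m : ℕ}

/-! ### Algebra of the filter: estimates, errors and innovations. -/

namespace Model

open Matrix

variable (M : Model n p m) (L : Matrix (Fin p) (Fin n) ℝ)

/-- The a priori estimates `x̂_{k|k-1}` computed from the outputs `y` and the watermark `δ`. -/
noncomputable def estimate (δ : ℕ → Fin p → ℝ) (x : Fin n → ℝ) (y : ℕ → Fin m → ℝ) :
    ℕ → Fin n → ℝ
  | 0 => x
  | k + 1 =>
    let xpost := (1 - M.gain * M.C) *ᵥ estimate δ x y k + M.gain *ᵥ y k
    M.A *ᵥ xpost + M.B *ᵥ (L *ᵥ xpost + δ k)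

/-- The a priori estimation errors `x_k - x̂_{k|k-1}` of the genuine system. -/
noncomputable def estError (e : Fin n → ℝ) (w : ℕ → Fin n → ℝ) (v : ℕ → Fin m → ℝ) :
    ℕ → Fin n → ℝ
  | 0 => e
  | k + 1 => M.A *ᵥ (estError e w v k - M.gain *ᵥ (M.C *ᵥ estError e w v k + v k)) + w k

theorem trajectory_snd (δ : ℕ → Fin p → ℝ) (d : ℕ → (Fin m → ℝ) → Fin m → ℝ)
    (s : (Fin n → ℝ) × (Fin n → ℝ)) (w : ℕ → Fin n → ℝ) (v : ℕ → Fin m → ℝ) (k : ℕ) :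
    (M.trajectory L δ d s w v k).2 = M.estimate L δ s.2 (M.output L δ d s w v) k := by
  induction k with
  | zero => rfl
  | succ k ih => rw [estimate, ← ih]; rfl

theorem trajectory_sub (δ : ℕ → Fin p → ℝ) (s : (Fin n → ℝ) × (Fin n → ℝ)) (w : ℕ → Fin n → ℝ)
    (v : ℕ → Fin m → ℝ) (k : ℕ) :
    (M.trajectory L δ 0 s w v k).1 - (M.trajectory L δ 0 s w v k).2 =
      M.estError (s.1 - s.2) w v k := by
  induction k with
  | zero => rfl
  | succ k ih =>
    rw [estError, ← ih]
    simp only [trajectory, step, reading, Pi.zero_apply, add_zero, sub_mulVec, one_mulVec,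
      mulVec_sub, mulVec_add, mulVec_mulVec]
    abel

/-- The innovations of the genuine system are driven by the estimation error. -/
theorem output_sub_estimate (δ : ℕ → Fin p → ℝ) (s : (Fin n → ℝ) × (Fin n → ℝ))
    (w : ℕ → Fin n → ℝ) (v : ℕ → Fin m → ℝ) (k : ℕ) :
    M.output L δ 0 s w v k - M.C *ᵥ M.estimate L δ s.2 (M.output L δ 0 s w v) k =
      M.C *ᵥ M.estError (s.1 - s.2) w v k + v k := by
  rw [← trajectory_snd, ← trajectory_sub M L δ, mulVec_sub]
  simp only [output, reading, Pi.zero_apply, add_zero]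
  abel

/-- The common outputs cancel, so only the loop matrix and the watermark difference remain. This is
how the watermark becomes visible under replay. -/
theorem estimate_sub (δ δ' : ℕ → Fin p → ℝ) (x x' : Fin n → ℝ) (y : ℕ → Fin m → ℝ) (k : ℕ) :
    M.estimate L δ x y k - M.estimate L δ' x' y k =
      linearState (M.loopMatrix L) M.B (x - x') (fun j => δ j - δ' j) k := by
  induction k with
  | zero => rfl
  | succ k ih =>
    rw [linearState, ← ih]
    simp only [estimate, loopMatrix, sub_mulVec, one_mulVec, mulVec_sub, mulVec_add, mulVec_mulVec,
      Matrix.mul_sub, Matrix.add_mul, add_mulVec, Matrix.mul_one, Matrix.mul_assoc]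
    abel

theorem estimate_congr (δ : ℕ → Fin p → ℝ) (x : Fin n → ℝ) {y y' : ℕ → Fin m → ℝ} {k : ℕ}
    (h : ∀ j < k, y j = y' j) : M.estimate L δ x y k = M.estimate L δ x y' k := by
  induction k with
  | zero => rfl
  | succ k ih =>
    simp only [estimate]
    rw [ih fun j hj => h j (hj.trans k.lt_succ_self), h k k.lt_succ_self]

theorem continuous_estimate (δ : ℕ → Fin p → ℝ) (x : Fin n → ℝ) (k : ℕ) :
    Continuous fun y : ℕ → Fin m → ℝ => M.estimate L δ x y k := by
  induction k with
  | zero => exact continuous_const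
  | succ k ih =>
    simp only [estimate]
    fun_prop

theorem gain_mul_innovCov (hP : M.innovCov.PosDef) : M.gain * M.innovCov = M.P * M.Cᵀ := by
  rw [gain, Matrix.mul_assoc, nonsing_inv_mul _ ((isUnit_iff_isUnit_det _).1 hP.isUnit),
    Matrix.mul_one]

theorem gain_transpose_mul (hP : M.innovCov.PosDef) : M.innovCov * M.gainᵀ = M.C * M.P := by
  have h1 : M.innovCovᵀ = M.innovCov := hP.isHermitian
  have h2 : M.Pᵀ = M.P := M.P_psd.isHermitian
  have h := congrArg transpose (M.gain_mul_innovCov hP)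
  rwa [transpose_mul, transpose_mul, h1, h2, transpose_transpose] at h

/-- Whatever functional of the innovations and of the current error is a functional of the initial
error and of the noises, of the same variance as if the innovations were white. -/
theorem exists_innovation_functional (hP : M.innovCov.PosDef) (hM : M.FilterSteady)
    (τ : ℕ → Fin m → ℝ) (T : ℕ) (s : Fin n → ℝ) :
    ∃ (a : Fin n → ℝ) (α : ℕ → Fin n → ℝ) (β : ℕ → Fin m → ℝ),
      (∀ e w v, ∑ k ∈ Finset.range T, τ k ⬝ᵥ (M.C *ᵥ M.estError e w v k + v k) +
        s ⬝ᵥ M.estError e w v T = a ⬝ᵥ e + (∑ j ∈ Finset.range T, α j ⬝ᵥ w j +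
          ∑ j ∈ Finset.range T, β j ⬝ᵥ v j)) ∧
      a ⬝ᵥ M.P *ᵥ a + (∑ j ∈ Finset.range T, α j ⬝ᵥ M.Q *ᵥ α j +
        ∑ j ∈ Finset.range T, β j ⬝ᵥ M.R *ᵥ β j) =
        ∑ k ∈ Finset.range T, τ k ⬝ᵥ M.innovCov *ᵥ τ k + s ⬝ᵥ M.P *ᵥ s := by
  induction T generalizing s with
  | zero => exact ⟨s, 0, 0, by simp [estError], by simp⟩
  | succ T ih =>
    set F := M.A * (1 - M.gain * M.C) with hF
    -- One backward step of the adjoint recursion: `e_{T+1} = F e_T - A K v_T + w_T`, so the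
    -- functional puts `Cᵀ τ_T + Fᵀ s` on `e_T`, `s` on `w_T` and `b` on `v_T`.
    obtain ⟨a, α, β, h1, h2⟩ := ih (M.Cᵀ *ᵥ τ T + Fᵀ *ᵥ s)
    set b := τ T - (M.A * M.gain)ᵀ *ᵥ s with hb
    have hα : ∀ (f : (Fin n → ℝ) → ℕ → ℝ), ∑ j ∈ Finset.range (T + 1),
        f (Function.update α T s j) j = ∑ j ∈ Finset.range T, f (α j) j + f s T := fun f => by
      rw [Finset.sum_range_succ, Function.update_self]
      congr 1
      refine Finset.sum_congr rfl fun j hj => ?_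
      rw [Function.update_of_ne (Finset.mem_range.1 hj).ne]
    have hβ : ∀ (f : (Fin m → ℝ) → ℕ → ℝ), ∑ j ∈ Finset.range (T + 1),
        f (Function.update β T b j) j = ∑ j ∈ Finset.range T, f (β j) j + f b T := fun f => by
      rw [Finset.sum_range_succ, Function.update_self]
      congr 1
      refine Finset.sum_congr rfl fun j hj => ?_
      rw [Function.update_of_ne (Finset.mem_range.1 hj).ne]
    have htr : ∀ {μ ν : ℕ} (N : Matrix (Fin μ) (Fin ν) ℝ) (x : Fin μ → ℝ) (y : Fin ν → ℝ),
        (Nᵀ *ᵥ x) ⬝ᵥ y = x ⬝ᵥ N *ᵥ y := fun N x y => by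
      rw [dotProduct_mulVec, mulVec_transpose]
    refine ⟨a, Function.update α T s, Function.update β T b, fun e w v => ?_, ?_⟩
    · rw [hα fun x j => x ⬝ᵥ w j, hβ fun x j => x ⬝ᵥ v j, Finset.sum_range_succ, estError]
      have h3 := h1 e w v
      have h4 : s ⬝ᵥ (M.A *ᵥ (M.estError e w v T - M.gain *ᵥ (M.C *ᵥ M.estError e w v T + v T)) +
          w T) = (Fᵀ *ᵥ s) ⬝ᵥ M.estError e w v T + s ⬝ᵥ w T -
            ((M.A * M.gain)ᵀ *ᵥ s) ⬝ᵥ v T := by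
        rw [htr, htr, hF]
        simp only [mulVec_add, mulVec_sub, dotProduct_add, dotProduct_sub, Matrix.mul_sub,
          sub_mulVec, mulVec_mulVec, Matrix.mul_one]
        ring
      rw [h4, hb, sub_dotProduct, dotProduct_add]
      rw [add_dotProduct, htr] at h3
      linarith
    · rw [hα fun x _ => x ⬝ᵥ M.Q *ᵥ x, hβ fun x _ => x ⬝ᵥ M.R *ᵥ x, Finset.sum_range_succ]
      have hPt : M.Pᵀ = M.P := M.P_psd.isHermitian
      have hRt : M.Rᵀ = M.R := M.R_psd.isHermitian
      have key : (M.Cᵀ *ᵥ τ T + Fᵀ *ᵥ s) ⬝ᵥ M.P *ᵥ (M.Cᵀ *ᵥ τ T + Fᵀ *ᵥ s) + s ⬝ᵥ M.Q *ᵥ s +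
          b ⬝ᵥ M.R *ᵥ b = τ T ⬝ᵥ M.innovCov *ᵥ τ T + s ⬝ᵥ M.P *ᵥ s := by
        have hR : M.R = M.innovCov - M.C * M.P * M.Cᵀ := by rw [innovCov]; abel
        have hcross : M.C * M.P * Fᵀ - M.R * (M.A * M.gain)ᵀ = 0 := by
          have := M.gain_transpose_mul hP
          rw [hR, hF]
          simp only [transpose_mul, transpose_sub, Matrix.mul_sub, Matrix.sub_mul,
            Matrix.mul_one, ← Matrix.mul_assoc, this]
          abel
        have hcross' : F * M.P * M.Cᵀ - M.A * M.gain * M.R = 0 := by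
          have := congrArg transpose hcross
          simpa [transpose_mul, transpose_sub, hPt, hRt, Matrix.mul_assoc] using this
        -- The Joseph form of the Riccati equation: the error covariance `P` is stationary.
        have hss : F * M.P * Fᵀ + M.Q + M.A * M.gain * M.R * (M.A * M.gain)ᵀ = M.P := by
          have h5 : M.A * M.gain * M.R = F * M.P * M.Cᵀ := (sub_eq_zero.1 hcross').symm
          have h6 : F * M.P * Fᵀ = F * M.P * M.Aᵀ - F * M.P * M.Cᵀ * M.gainᵀ * M.Aᵀ := by
            rw [hF]
            simp only [transpose_mul, transpose_sub, Matrix.mul_sub, Matrix.sub_mul,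
              Matrix.mul_one, ← Matrix.mul_assoc]
          rw [h5, h6, transpose_mul, ← Matrix.mul_assoc, hF]
          conv_rhs => rw [hM]
          simp only [Matrix.mul_sub, Matrix.sub_mul, Matrix.mul_one, ← Matrix.mul_assoc]
          abel
        have e1 : s ⬝ᵥ M.P *ᵥ s = s ⬝ᵥ (F * M.P * Fᵀ) *ᵥ s + s ⬝ᵥ M.Q *ᵥ s +
            s ⬝ᵥ (M.A * M.gain * M.R * (M.A * M.gain)ᵀ) *ᵥ s := by
          rw [← dotProduct_add, ← dotProduct_add, ← add_mulVec, ← add_mulVec, hss]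
        have e2 : τ T ⬝ᵥ M.innovCov *ᵥ τ T =
            τ T ⬝ᵥ (M.C * M.P * M.Cᵀ) *ᵥ τ T + τ T ⬝ᵥ M.R *ᵥ τ T := by
          rw [← dotProduct_add, ← add_mulVec]; rfl
        have e3 : τ T ⬝ᵥ (M.C * M.P * Fᵀ) *ᵥ s = τ T ⬝ᵥ (M.R * (M.A * M.gain)ᵀ) *ᵥ s := by
          rw [sub_eq_zero.1 hcross]
        have e4 : s ⬝ᵥ (F * M.P * M.Cᵀ) *ᵥ τ T = s ⬝ᵥ (M.A * M.gain * M.R) *ᵥ τ T := by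
          rw [sub_eq_zero.1 hcross']
        rw [hb]
        simp only [mulVec_add, mulVec_sub, dotProduct_add, dotProduct_sub, add_dotProduct,
          sub_dotProduct, htr, mulVec_mulVec, ← Matrix.mul_assoc] at e1 e2 e3 e4 ⊢
        linarith
      linarith

end Model

/-! ### Invariance of the divergence. -/

section Divergence

variable {α β : Type*} [MeasurableSpace α] [MeasurableSpace β]

/-- Data processing inequality for `f` and for its measurable left inverse. -/
theorem klDiv_map_of_measurableEmbedding [Nonempty α] (μ ν : Measure α) [IsFiniteMeasure μ]
    [IsFiniteMeasure ν] {f : α → β} (hf : MeasurableEmbedding f) :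
    klDiv (μ.map f) (ν.map f) = klDiv μ ν := by
  refine le_antisymm (klDiv_map_le μ ν hf.measurable) ?_
  have h := klDiv_map_le (μ.map f) (ν.map f) hf.measurable_invFun
  rwa [Measure.map_map hf.measurable_invFun hf.measurable,
    Measure.map_map hf.measurable_invFun hf.measurable, hf.leftInverse_invFun.comp_eq_id,
    Measure.map_id, Measure.map_id] at h

end Divergence

/-! ### The innovation map and the laws of its ingredients. -/

namespace Model

open Matrix

variable (M : Model n p m) (L : Matrix (Fin p) (Fin n) ℝ)

/-- A finite sequence of outputs, continued by zeros. -/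
def extendOutputs {T : ℕ} (y : Fin T → Fin m → ℝ) (k : ℕ) : Fin m → ℝ :=
  if h : k < T then y ⟨k, h⟩ else 0

theorem continuous_extendOutputs (T : ℕ) :
    Continuous fun y : Fin T → Fin m → ℝ => extendOutputs y := by
  refine continuous_pi fun k => ?_
  unfold extendOutputs
  split_ifs
  · exact continuous_apply _
  · exact continuous_const

/-- The innovations `y_k - C x̂_{k|k-1}`, normalized by `H`, of the filter started from `x̂₀` and
run on the outputs `y`. -/
noncomputable def innovation (H : Matrix (Fin m) (Fin m) ℝ) (δ : ℕ → Fin p → ℝ) {T : ℕ}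
    (y : Fin T → Fin m → ℝ) : EuclideanSpace ℝ (Fin T × Fin m) :=
  WithLp.toLp 2 fun k =>
    (H *ᵥ (y k.1 - M.C *ᵥ M.estimate L δ M.xhat0 (extendOutputs y) k.1)) k.2

theorem innovation_apply (H : Matrix (Fin m) (Fin m) ℝ) (δ : ℕ → Fin p → ℝ) (T : ℕ)
    (y : ℕ → Fin m → ℝ) :
    M.innovation L H δ (fun k : Fin T => y k) = WithLp.toLp 2 fun k =>
      (H *ᵥ (y k.1 - M.C *ᵥ M.estimate L δ M.xhat0 y k.1)) k.2 := by
  unfold innovation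
  congr 1
  ext k
  rw [M.estimate_congr L δ M.xhat0 (y := extendOutputs fun k : Fin T => y k) (y' := y)
    fun j hj => ?_]
  simp [extendOutputs, hj.trans k.1.2]

theorem continuous_innovation (H : Matrix (Fin m) (Fin m) ℝ) (δ : ℕ → Fin p → ℝ) (T : ℕ) :
    Continuous fun y : Fin T → Fin m → ℝ => M.innovation L H δ y := by
  have h : ∀ k, Continuous fun y : Fin T → Fin m → ℝ =>
      M.estimate L δ M.xhat0 (extendOutputs y) k := fun k =>
    (M.continuous_estimate L δ M.xhat0 k).comp (continuous_extendOutputs T)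
  unfold innovation
  refine (PiLp.continuous_toLp 2 _).comp (continuous_pi fun k => ?_)
  have := h k.1
  fun_prop

/-- The map is causal and triangular: once the earlier outputs agree, so do the estimates, and the
current innovation determines the current output. -/
theorem injective_innovation {H : Matrix (Fin m) (Fin m) ℝ} (hH : IsUnit H) (δ : ℕ → Fin p → ℝ)
    (T : ℕ) : Function.Injective fun y : Fin T → Fin m → ℝ => M.innovation L H δ y := by
  intro y y' h
  have h1 : ∀ k : Fin T, y k - M.C *ᵥ M.estimate L δ M.xhat0 (extendOutputs y) k =
      y' k - M.C *ᵥ M.estimate L δ M.xhat0 (extendOutputs y') k := fun k => by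
    refine mulVec_injective_of_isUnit hH (funext fun i => ?_)
    exact congrFun (congrArg WithLp.ofLp h) (k, i)
  have h2 : ∀ k : ℕ, extendOutputs y k = extendOutputs y' k := fun k => by
    induction k using Nat.strong_induction_on with
    | _ k ih =>
      by_cases hk : k < T
      · have h3 := h1 ⟨k, hk⟩
        rw [M.estimate_congr L δ M.xhat0 ih] at h3
        simpa [extendOutputs, hk] using h3
      · simp [extendOutputs, hk]
  ext1 k
  simpa [extendOutputs] using h2 k

theorem measurableEmbedding_innovation {H : Matrix (Fin m) (Fin m) ℝ} (hH : IsUnit H)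
    (δ : ℕ → Fin p → ℝ) (T : ℕ) :
    MeasurableEmbedding fun y : Fin T → Fin m → ℝ => M.innovation L H δ y :=
  (M.continuous_innovation L H δ T).measurableEmbedding (M.injective_innovation L hH δ T)

theorem continuous_output (k : ℕ) : Continuous
    fun q : (((Fin n → ℝ) × (Fin n → ℝ)) × (ℕ → Fin n → ℝ) × (ℕ → Fin m → ℝ)) × (ℕ → Fin p → ℝ) =>
      M.output L q.2 0 q.1.1 q.1.2.1 q.1.2.2 k := by
  have h : Continuous fun q : (((Fin n → ℝ) × (Fin n → ℝ)) × (ℕ → Fin n → ℝ) × (ℕ → Fin m → ℝ)) ×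
      (ℕ → Fin p → ℝ) => M.trajectory L q.2 0 q.1.1 q.1.2.1 q.1.2.2 k := by
    induction k with
    | zero => simp only [trajectory]; fun_prop
    | succ k ih =>
      simp only [trajectory, step, reading, Pi.zero_apply, add_zero]
      fun_prop
  simp only [output, reading, Pi.zero_apply, add_zero]
  fun_prop

/-- `τ_k = Hᵀ t_k` and no weight on the final error; then `H 𝒫 Hᵀ = 1` turns the variance into `t ⬝ᵥ
t`. -/
theorem exists_normalized_innovation_functional (hP : M.innovCov.PosDef) (hM : M.FilterSteady)
    {H : Matrix (Fin m) (Fin m) ℝ} (hH : H * M.innovCov * Hᵀ = 1) (T : ℕ)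
    (t : Fin T × Fin m → ℝ) :
    ∃ (a : Fin n → ℝ) (α : ℕ → Fin n → ℝ) (β : ℕ → Fin m → ℝ),
      (∀ e w v, (t ⬝ᵥ fun k => (H *ᵥ (M.C *ᵥ M.estError e w v k.1 + v k.1)) k.2) =
        a ⬝ᵥ e + (∑ j ∈ Finset.range T, α j ⬝ᵥ w j + ∑ j ∈ Finset.range T, β j ⬝ᵥ v j)) ∧
      a ⬝ᵥ M.P *ᵥ a + (∑ j ∈ Finset.range T, α j ⬝ᵥ M.Q *ᵥ α j +
        ∑ j ∈ Finset.range T, β j ⬝ᵥ M.R *ᵥ β j) = t ⬝ᵥ t := by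
  obtain ⟨a, α, β, h1, h2⟩ := M.exists_innovation_functional hP hM
    (fun k => Hᵀ *ᵥ extendOutputs (fun k i => t (k, i)) k) T 0
  refine ⟨a, α, β, fun e w v => ?_, ?_⟩
  · rw [← h1, zero_dotProduct, add_zero, Finset.sum_range, dotProduct, Fintype.sum_prod_type]
    refine Finset.sum_congr rfl fun k _ => ?_
    rw [mulVec_transpose, ← dotProduct_mulVec]
    simp [dotProduct, extendOutputs]
  · rw [h2, zero_dotProduct, add_zero, Finset.sum_range, dotProduct, Fintype.sum_prod_type]
    refine Finset.sum_congr rfl fun k _ => ?_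
    rw [dotProduct_mulVec_conj, transpose_transpose, hH, one_mulVec]
    simp [dotProduct, extendOutputs]

instance isProbabilityMeasure_noiseLaw : IsProbabilityMeasure M.noiseLaw := by
  unfold noiseLaw; infer_instance

theorem integral_cexp_noiseLaw (α : ℕ → Fin n → ℝ) (β : ℕ → Fin m → ℝ) (T : ℕ) :
    ∫ q, Complex.exp ((∑ j ∈ Finset.range T, α j ⬝ᵥ q.1 j + ∑ j ∈ Finset.range T, β j ⬝ᵥ q.2 j :
      ℝ) * Complex.I) ∂M.noiseLaw =
      Complex.exp (-((∑ j ∈ Finset.range T, α j ⬝ᵥ M.Q *ᵥ α j +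
        ∑ j ∈ Finset.range T, β j ⬝ᵥ M.R *ᵥ β j : ℝ) : ℂ) / 2) := by
  simp only [Complex.ofReal_add, add_mul, Complex.exp_add]
  rw [noiseLaw, integral_prod_mul
    (fun w : ℕ → Fin n → ℝ => Complex.exp ((∑ j ∈ Finset.range T, α j ⬝ᵥ w j : ℝ) * Complex.I))
    (fun v : ℕ → Fin m → ℝ => Complex.exp ((∑ j ∈ Finset.range T, β j ⬝ᵥ v j : ℝ) * Complex.I)),
    integral_cexp_infinitePi_gaussianVec M.Q_psd, integral_cexp_infinitePi_gaussianVec M.R_psd,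
    ← Complex.exp_add]
  congr 1
  ring

variable {L}

/-- The error is independent of the estimate with known law, so only the law of the estimate stays
unspecified. -/
theorem IsSteadyState.integral_cexp {W : Matrix (Fin p) (Fin p) ℝ}
    {π : Measure ((Fin n → ℝ) × (Fin n → ℝ))} (hπ : M.IsSteadyState L W π) (a b : Fin n → ℝ) :
    ∫ s, Complex.exp ((a ⬝ᵥ (s.1 - s.2) + b ⬝ᵥ s.2 : ℝ) * Complex.I) ∂π =
      Complex.exp (-((a ⬝ᵥ M.P *ᵥ a : ℝ) : ℂ) / 2) *
        ∫ x, Complex.exp ((b ⬝ᵥ x : ℝ) * Complex.I) ∂(π.map Prod.snd) := by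
  simp only [Complex.ofReal_add, add_mul, Complex.exp_add]
  have hf : ∀ c : Fin n → ℝ,
      Continuous fun x : Fin n → ℝ => Complex.exp ((c ⬝ᵥ x : ℝ) * Complex.I) := fun c => by fun_prop
  have hind := hπ.error_indep.comp (hf a).measurable (hf b).measurable
  have h := hind.integral_fun_mul_eq_mul_integral
    (Continuous.aestronglyMeasurable (by unfold Function.comp; fun_prop))
    (Continuous.aestronglyMeasurable (by unfold Function.comp; fun_prop))
  simp only [Function.comp_apply] at h
  rw [h, integral_map (by fun_prop) (hf b).aestronglyMeasurable]
  congr 1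
  have h2 := integral_cexp_gaussianVec 0 M.P_psd a
  rw [← hπ.error_law, integral_map (by fun_prop) (hf a).aestronglyMeasurable] at h2
  rw [h2]
  congr 1
  simp
  ring

end Model

/-! ### Output laws with and without attack, and their divergence. -/

namespace Model

open Matrix

variable (M : Model n p m) (L : Matrix (Fin p) (Fin n) ℝ) (W : Matrix (Fin p) (Fin p) ℝ)
  (π : Measure ((Fin n → ℝ) × (Fin n → ℝ))) (δ : ℕ → Fin p → ℝ)

theorem measurable_output : Measurable
    fun (q : (((Fin n → ℝ) × (Fin n → ℝ)) × (ℕ → Fin n → ℝ) × (ℕ → Fin m → ℝ)) × (ℕ → Fin p → ℝ))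
      (k : ℕ) => M.output L q.2 0 q.1.1 q.1.2.1 q.1.2.2 k :=
  measurable_pi_lambda _ fun k => (M.continuous_output L k).measurable

theorem isProbabilityMeasure_recordLaw [IsProbabilityMeasure π] :
    IsProbabilityMeasure (M.recordLaw L W π) :=
  Measure.isProbabilityMeasure_map (M.measurable_output L).aemeasurable

theorem measurable_restrictOutputs (T : ℕ) :
    Measurable fun (y : ℕ → Fin m → ℝ) (k : Fin T) => y k :=
  measurable_pi_lambda _ fun _ => measurable_pi_apply _

theorem outputLaw_zero [IsProbabilityMeasure π] (T : ℕ) :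
    M.outputLaw L W π δ 0 T = ((gaussianVec M.xhat0 M.P).prod M.noiseLaw).map
      (fun ω (k : Fin (T + 1)) => M.output L δ 0 (ω.1, M.xhat0) ω.2.1 ω.2.2 k) := by
  have := M.isProbabilityMeasure_recordLaw L W π
  have h : Measurable fun (ω : (Fin n → ℝ) × (ℕ → Fin n → ℝ) × (ℕ → Fin m → ℝ))
      (k : Fin (T + 1)) => M.output L δ 0 (ω.1, M.xhat0) ω.2.1 ω.2.2 k :=
    (measurable_restrictOutputs (T + 1)).comp ((M.measurable_output L).comp
      (f := fun ω : (Fin n → ℝ) × (ℕ → Fin n → ℝ) × (ℕ → Fin m → ℝ) =>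
        (((ω.1, M.xhat0), ω.2), δ)) (by fun_prop))
  have h2 : ((M.recordLaw L W π).prod ((gaussianVec M.xhat0 M.P).prod M.noiseLaw)).map Prod.snd =
      (gaussianVec M.xhat0 M.P).prod M.noiseLaw := by
    rw [← Measure.snd, Measure.snd_prod]
  conv_rhs => rw [← h2, Measure.map_map h measurable_snd]
  rfl

/-- The injected bias cancels the genuine reading, so the delivered output is the record and the
current initial state and noises integrate out. -/
theorem outputLaw_replayAttack [IsProbabilityMeasure π] (T : ℕ) :
    M.outputLaw L W π δ (replayAttack m) T =
      ((π.prod M.noiseLaw).prod (Measure.infinitePi fun _ : ℕ => gaussianVec 0 W)).map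
        (fun ω (k : Fin (T + 1)) => M.output L ω.2 0 ω.1.1 ω.1.2.1 ω.1.2.2 k) := by
  have := M.isProbabilityMeasure_recordLaw L W π
  have h1 : M.outputLaw L W π δ (replayAttack m) T =
      ((M.recordLaw L W π).prod ((gaussianVec M.xhat0 M.P).prod M.noiseLaw)).map
        ((fun (y : ℕ → Fin m → ℝ) (k : Fin (T + 1)) => y k) ∘ Prod.fst) := by
    unfold outputLaw
    congr 1
    ext ω k
    simp [output, reading, replayAttack]
  rw [h1, ← Measure.map_map (measurable_restrictOutputs _) measurable_fst, ← Measure.fst,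
    Measure.fst_prod, recordLaw,
    Measure.map_map (measurable_restrictOutputs _) (M.measurable_output L)]
  rfl

variable {L W π}

/-- Without attack, the normalized innovations are white. -/
theorem map_innovation_outputLaw_zero (hP : M.innovCov.PosDef) (hM : M.FilterSteady)
    [IsProbabilityMeasure π] {H : Matrix (Fin m) (Fin m) ℝ} (hH : H * M.innovCov * Hᵀ = 1)
    (T : ℕ) : (M.outputLaw L W π δ 0 T).map (M.innovation L H δ) = stdGaussian _ := by
  have hf : Measurable fun (ω : (Fin n → ℝ) × (ℕ → Fin n → ℝ) × (ℕ → Fin m → ℝ))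
      (k : Fin (T + 1)) => M.output L δ 0 (ω.1, M.xhat0) ω.2.1 ω.2.2 k :=
    (measurable_restrictOutputs (T + 1)).comp ((M.measurable_output L).comp
      (f := fun ω : (Fin n → ℝ) × (ℕ → Fin n → ℝ) × (ℕ → Fin m → ℝ) =>
        (((ω.1, M.xhat0), ω.2), δ)) (by fun_prop))
  have hΦ := (M.continuous_innovation L H δ (T + 1)).measurable
  rw [outputLaw_zero, Measure.map_map hΦ hf]
  have := Measure.isProbabilityMeasure_map (μ := (gaussianVec M.xhat0 M.P).prod M.noiseLaw)
    (hΦ.comp hf).aemeasurable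
  refine Measure.ext_of_charFun (funext fun t => ?_)
  obtain ⟨a, α, β, h1, h2⟩ := M.exists_normalized_innovation_functional hP hM hH (T + 1) t.ofLp
  have h3 : ∀ ω : (Fin n → ℝ) × (ℕ → Fin n → ℝ) × (ℕ → Fin m → ℝ),
      inner ℝ (M.innovation L H δ fun k : Fin (T + 1) =>
        M.output L δ 0 (ω.1, M.xhat0) ω.2.1 ω.2.2 k) t = (a ⬝ᵥ ω.1 - a ⬝ᵥ M.xhat0) +
          (∑ j ∈ Finset.range (T + 1), α j ⬝ᵥ ω.2.1 j +
            ∑ j ∈ Finset.range (T + 1), β j ⬝ᵥ ω.2.2 j) := fun ω => by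
    rw [inner_eq_dotProduct, dotProduct_comm, innovation_apply, ← dotProduct_sub, ← h1]
    congr 1
    ext k
    exact congrArg (fun z => (H *ᵥ z) k.2)
      (M.output_sub_estimate L δ (ω.1, M.xhat0) ω.2.1 ω.2.2 k.1)
  rw [charFun_stdGaussian, charFun_apply, integral_map (hΦ.comp hf).aemeasurable
    (Continuous.aestronglyMeasurable (by fun_prop))]
  simp only [Function.comp_apply, h3]
  simp only [Complex.ofReal_add (_ - _), add_mul, Complex.exp_add]
  rw [integral_prod_mul
    (fun x : Fin n → ℝ => Complex.exp (((a ⬝ᵥ x - a ⬝ᵥ M.xhat0 : ℝ) : ℂ) * Complex.I))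
    (fun q : (ℕ → Fin n → ℝ) × (ℕ → Fin m → ℝ) =>
      Complex.exp (((∑ j ∈ Finset.range (T + 1), α j ⬝ᵥ q.1 j +
            ∑ j ∈ Finset.range (T + 1), β j ⬝ᵥ q.2 j : ℝ) : ℂ) * Complex.I)),
    integral_cexp_noiseLaw]
  have h4 : ∀ x : Fin n → ℝ, Complex.exp (((a ⬝ᵥ x - a ⬝ᵥ M.xhat0 : ℝ) : ℂ) * Complex.I) =
      Complex.exp ((a ⬝ᵥ x : ℝ) * Complex.I) *
        Complex.exp (-((a ⬝ᵥ M.xhat0 : ℝ) * Complex.I)) := fun x => by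
    rw [← Complex.exp_add]
    congr 1
    push_cast
    ring
  simp only [h4]
  rw [integral_mul_const, integral_cexp_gaussianVec _ M.P_psd, ← Complex.exp_add,
    ← Complex.exp_add]
  have h5 : ‖t‖ ^ 2 = t.ofLp ⬝ᵥ t.ofLp := by
    rw [← inner_eq_dotProduct, real_inner_self_eq_norm_sq]
  rw [← Complex.ofReal_pow, h5, ← h2]
  congr 1
  push_cast
  ring

/-- The attacked innovations are the recorded white ones, plus the response to the recorded estimate
and watermarks, minus the deterministic response to `x̂₀` and `δ`. The random sources are
independent, so their characteristic functions multiply. -/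
theorem charFun_map_innovation_outputLaw_replayAttack (hP : M.innovCov.PosDef)
    (hM : M.FilterSteady) (hW : W.PosSemidef) (hπ : M.IsSteadyState L W π)
    [IsProbabilityMeasure π] {H : Matrix (Fin m) (Fin m) ℝ}
    (hH : H * M.innovCov * Hᵀ = 1) {c : Fin n → ℝ} {V : Matrix (Fin n) (Fin n) ℝ}
    (hcV : ∀ b : Fin n → ℝ, ∫ x, Complex.exp ((b ⬝ᵥ x : ℝ) * Complex.I) ∂(π.map Prod.snd) =
      Complex.exp ((b ⬝ᵥ c : ℝ) * Complex.I - ((b ⬝ᵥ V *ᵥ b : ℝ) : ℂ) / 2)) (T : ℕ)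
    (t : EuclideanSpace ℝ (Fin (T + 1) × Fin m)) :
    charFun ((M.outputLaw L W π δ (replayAttack m) T).map (M.innovation L H δ)) t =
      Complex.exp ((-(t.ofLp ⬝ᵥ fun k => ((H * M.C) *ᵥ
        linearState (M.loopMatrix L) M.B (M.xhat0 - c) δ k.1) k.2) : ℝ) * Complex.I -
        ((t.ofLp ⬝ᵥ (1 + responseCov (M.loopMatrix L) M.B (H * M.C) W V (T + 1)) *ᵥ t.ofLp : ℝ) :
          ℂ) / 2) := by
  have hf : Measurable
      fun (ω : (((Fin n → ℝ) × (Fin n → ℝ)) × (ℕ → Fin n → ℝ) × (ℕ → Fin m → ℝ)) × (ℕ → Fin p → ℝ))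
        (k : Fin (T + 1)) => M.output L ω.2 0 ω.1.1 ω.1.2.1 ω.1.2.2 k :=
    (measurable_restrictOutputs (T + 1)).comp (M.measurable_output L)
  have hΦ := (M.continuous_innovation L H δ (T + 1)).measurable
  rw [outputLaw_replayAttack, Measure.map_map hΦ hf]
  obtain ⟨a, α, β, h1, h2⟩ := M.exists_normalized_innovation_functional hP hM hH (T + 1) t.ofLp
  set b := (obsMatrix (M.loopMatrix L) (H * M.C) (T + 1))ᵀ *ᵥ t.ofLp with hb
  set γ : ℕ → Fin p → ℝ := fun j =>
    (inputMatrix (M.loopMatrix L) M.B (H * M.C) (T + 1) j)ᵀ *ᵥ t.ofLp with hγ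
  set r := t.ofLp ⬝ᵥ fun k => ((H * M.C) *ᵥ
    linearState (M.loopMatrix L) M.B M.xhat0 δ k.1) k.2 with hr
  have h3 : ∀ ω : (((Fin n → ℝ) × (Fin n → ℝ)) × (ℕ → Fin n → ℝ) × (ℕ → Fin m → ℝ)) ×
      (ℕ → Fin p → ℝ),
      inner ℝ (M.innovation L H δ fun k : Fin (T + 1) =>
        M.output L ω.2 0 ω.1.1 ω.1.2.1 ω.1.2.2 k) t =
          (((a ⬝ᵥ (ω.1.1.1 - ω.1.1.2) + b ⬝ᵥ ω.1.1.2) +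
            (∑ j ∈ Finset.range (T + 1), α j ⬝ᵥ ω.1.2.1 j +
            ∑ j ∈ Finset.range (T + 1), β j ⬝ᵥ ω.1.2.2 j)) +
          ∑ j ∈ Finset.range (T + 1), γ j ⬝ᵥ ω.2 j) + -r := fun ω => by
    have h4 := h1 (ω.1.1.1 - ω.1.1.2) ω.1.2.1 ω.1.2.2
    have h5 := dotProduct_response (M.loopMatrix L) M.B (H * M.C) ω.1.1.2 ω.2 (T + 1) t.ofLp
    -- Write `y - C x̂ = (y - C x̂') + C (x̂' - x̂)`, with `x̂'` the estimate of the recorded loop.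
    -- The first bracket is its genuine innovation, the second is handled by `estimate_sub`.
    have h6 : (fun k : Fin (T + 1) × Fin m => (H *ᵥ (M.output L ω.2 0 ω.1.1 ω.1.2.1 ω.1.2.2 k.1 -
        M.C *ᵥ M.estimate L δ M.xhat0 (M.output L ω.2 0 ω.1.1 ω.1.2.1 ω.1.2.2) k.1)) k.2) =
        ((fun k : Fin (T + 1) × Fin m => (H *ᵥ (M.C *ᵥ M.estError (ω.1.1.1 - ω.1.1.2) ω.1.2.1
            ω.1.2.2 k.1 + ω.1.2.2 k.1)) k.2) +
          fun k => ((H * M.C) *ᵥ linearState (M.loopMatrix L) M.B ω.1.1.2 ω.2 k.1) k.2) -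
          fun k => ((H * M.C) *ᵥ linearState (M.loopMatrix L) M.B M.xhat0 δ k.1) k.2 := by
      ext k
      have h7 := M.estimate_sub L ω.2 δ ω.1.1.2 M.xhat0
        (M.output L ω.2 0 ω.1.1 ω.1.2.1 ω.1.2.2) k.1
      rw [linearState_sub] at h7
      simp only [Pi.add_apply, Pi.sub_apply, ← Matrix.mulVec_mulVec]
      rw [← Pi.add_apply, ← Pi.sub_apply, ← mulVec_add, ← mulVec_sub, add_sub_assoc,
        ← mulVec_sub, ← h7, ← M.output_sub_estimate L ω.2, mulVec_sub M.C]
      congr 2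
      abel
    rw [inner_eq_dotProduct, dotProduct_comm, innovation_apply, h6, dotProduct_sub,
      dotProduct_add, h4, h5]
    ring
  rw [charFun_apply, integral_map (hΦ.comp hf).aemeasurable
    (Continuous.aestronglyMeasurable (by fun_prop))]
  simp only [Function.comp_apply, h3]
  simp only [Complex.ofReal_add _ (-r), Complex.ofReal_add _ (∑ j ∈ _, γ j ⬝ᵥ _),
    Complex.ofReal_add (_ + _) (_ + _), add_mul, Complex.exp_add]
  rw [integral_mul_const, integral_prod_mul
    (fun x : ((Fin n → ℝ) × (Fin n → ℝ)) × (ℕ → Fin n → ℝ) × (ℕ → Fin m → ℝ) =>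
      Complex.exp (((a ⬝ᵥ (x.1.1 - x.1.2) + b ⬝ᵥ x.1.2 : ℝ) : ℂ) * Complex.I) *
        Complex.exp (((∑ j ∈ Finset.range (T + 1), α j ⬝ᵥ x.2.1 j +
            ∑ j ∈ Finset.range (T + 1), β j ⬝ᵥ x.2.2 j : ℝ) : ℂ) * Complex.I))
    (fun u : ℕ → Fin p → ℝ =>
      Complex.exp (((∑ j ∈ Finset.range (T + 1), γ j ⬝ᵥ u j : ℝ) : ℂ) * Complex.I)),
    integral_prod_mul
    (fun x : (Fin n → ℝ) × (Fin n → ℝ) =>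
      Complex.exp (((a ⬝ᵥ (x.1 - x.2) + b ⬝ᵥ x.2 : ℝ) : ℂ) * Complex.I))
    (fun q : (ℕ → Fin n → ℝ) × (ℕ → Fin m → ℝ) =>
        Complex.exp (((∑ j ∈ Finset.range (T + 1), α j ⬝ᵥ q.1 j +
            ∑ j ∈ Finset.range (T + 1), β j ⬝ᵥ q.2 j : ℝ) : ℂ) * Complex.I)),
    integral_cexp_noiseLaw, hπ.integral_cexp, hcV, integral_cexp_infinitePi_gaussianVec hW]
  simp only [← Complex.exp_add]
  rw [add_mulVec, one_mulVec, dotProduct_add, dotProduct_responseCov, ← h2, dotProduct_response,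
    ← hb, dotProduct_sub]
  rw [dotProduct_response, ← hb] at hr
  rw [hr]
  congr 1
  push_cast
  ring

theorem klDiv_outputLaw_replayAttack (hP : M.innovCov.PosDef)
    (hM : M.FilterSteady) (hW : W.PosSemidef) (hπ : M.IsSteadyState L W π)
    {H : Matrix (Fin m) (Fin m) ℝ} (hH : H * M.innovCov * Hᵀ = 1)
    {c : Fin n → ℝ} {V : Matrix (Fin n) (Fin n) ℝ} (hV : V.PosSemidef)
    (hcV : ∀ b : Fin n → ℝ, ∫ x, Complex.exp ((b ⬝ᵥ x : ℝ) * Complex.I) ∂(π.map Prod.snd) =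
      Complex.exp ((b ⬝ᵥ c : ℝ) * Complex.I - ((b ⬝ᵥ V *ᵥ b : ℝ) : ℂ) / 2)) (T : ℕ) :
    klDiv (M.outputLaw L W π δ (replayAttack m) T) (M.outputLaw L W π δ 0 T) =
      ENNReal.ofReal (((responseCov (M.loopMatrix L) M.B (H * M.C) W V (T + 1)).trace -
        logDet (M.loopMatrix L) M.B (H * M.C) W V (T + 1) +
        ∑ k ∈ Finset.range (T + 1), linearState (M.loopMatrix L) M.B (M.xhat0 - c) δ k ⬝ᵥ
          ((H * M.C)ᵀ * (H * M.C)) *ᵥ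
            linearState (M.loopMatrix L) M.B (M.xhat0 - c) δ k) / 2) := by
  have := hπ.gaussian
  have hunit : IsUnit H := by
    rw [isUnit_iff_isUnit_det]
    refine isUnit_det_of_right_inverse (B := M.innovCov * Hᵀ) ?_
    rw [← Matrix.mul_assoc, hH]
  have he := M.measurableEmbedding_innovation L hunit δ (T + 1)
  have : IsFiniteMeasure (M.outputLaw L W π δ (replayAttack m) T) := by
    rw [outputLaw_replayAttack]; infer_instance
  have : IsFiniteMeasure (M.outputLaw L W π δ 0 T) := by
    rw [outputLaw_zero]; infer_instance
  have hG := responseCov_posSemidef (M.loopMatrix L) M.B (H * M.C) hW hV (T + 1)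
  have hS : (1 + responseCov (M.loopMatrix L) M.B (H * M.C) W V (T + 1)).PosDef :=
    PosDef.one.add_posSemidef hG
  set mean : EuclideanSpace ℝ (Fin (T + 1) × Fin m) := WithLp.toLp 2 (-fun k => ((H * M.C) *ᵥ
    linearState (M.loopMatrix L) M.B (M.xhat0 - c) δ k.1) k.2) with hmean
  have hlaw : (M.outputLaw L W π δ (replayAttack m) T).map (M.innovation L H δ) =
      multivariateGaussian mean (1 + responseCov (M.loopMatrix L) M.B (H * M.C) W V (T + 1)) := by
    refine Measure.ext_of_charFun (funext fun t => ?_)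
    rw [M.charFun_map_innovation_outputLaw_replayAttack δ hP hM hW hπ hH hcV,
      charFun_multivariateGaussian hS.posSemidef, inner_eq_dotProduct, hmean, dotProduct_neg]
  rw [← klDiv_map_of_measurableEmbedding _ _ he, hlaw,
    M.map_innovation_outputLaw_zero δ hP hM hH, klDiv_multivariateGaussian_stdGaussian mean hS]
  congr 2
  have hnorm : ‖mean‖ ^ 2 = ∑ k ∈ Finset.range (T + 1),
      linearState (M.loopMatrix L) M.B (M.xhat0 - c) δ k ⬝ᵥ ((H * M.C)ᵀ * (H * M.C)) *ᵥ
        linearState (M.loopMatrix L) M.B (M.xhat0 - c) δ k := by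
    rw [← real_inner_self_eq_norm_sq, inner_eq_dotProduct, hmean, neg_dotProduct_neg, dotProduct,
      Fintype.sum_prod_type, Finset.sum_range]
    refine Finset.sum_congr rfl fun k _ => ?_
    have := dotProduct_mulVec_conj (1 : Matrix (Fin m) (Fin m) ℝ) (H * M.C) (H * M.C)
      (linearState (M.loopMatrix L) M.B (M.xhat0 - c) δ k)
      (linearState (M.loopMatrix L) M.B (M.xhat0 - c) δ k)
    rw [one_mulVec, Matrix.mul_one] at this
    exact this
  rw [hnorm, trace_add, trace_one, logDet]
  ring

end Model

/-! ### The limit of the information flow. -/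

namespace Model

open Matrix

variable (M : Model n p m) {L : Matrix (Fin p) (Fin n) ℝ} {W : Matrix (Fin p) (Fin p) ℝ}
  {π : Measure ((Fin n → ℝ) × (Fin n → ℝ))}

theorem ae_tendsto_infoFlow_replayAttack (hW : W.PosSemidef) (hP : M.innovCov.PosDef)
    (hM : M.FilterSteady) (hπ : M.IsSteadyState L W π)
    (hA : Tendsto (fun k => M.loopMatrix L ^ k) atTop (𝓝 0)) {S : Matrix (Fin n) (Fin n) ℝ}
    (hS : S = M.loopMatrix L * S * (M.loopMatrix L)ᵀ + M.B * W * M.Bᵀ) :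
    ∃ ℓ : ℝ, (M.innovCov⁻¹ * M.C * S * M.Cᵀ).trace / 2 ≤ ℓ ∧
      ∀ᵐ δ ∂(Measure.infinitePi fun _ : ℕ => gaussianVec 0 W),
        Tendsto (fun T => M.infoFlow L W π δ (replayAttack m) T) atTop
          (𝓝 (ENNReal.ofReal ℓ)) := by
  obtain ⟨H, hHt, hH⟩ := exists_inv_sqrt hP
  have hH' : H * M.innovCov * Hᵀ = 1 := by rw [hHt, hH]
  have hinv : M.innovCov⁻¹ = H * H := by
    refine inv_eq_right_inv ?_
    rw [← Matrix.mul_assoc]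
    exact mul_eq_one_comm.1 (by rw [← Matrix.mul_assoc, hH])
  have hDS : ((H * M.C) * S * (H * M.C)ᵀ).trace = (M.innovCov⁻¹ * M.C * S * M.Cᵀ).trace := by
    rw [hinv, transpose_mul, hHt, ← Matrix.mul_assoc, trace_mul_comm]
    simp only [Matrix.mul_assoc]
  have hDS' : ((H * M.C)ᵀ * (H * M.C) * S).trace = (M.innovCov⁻¹ * M.C * S * M.Cᵀ).trace := by
    rw [Matrix.mul_assoc, trace_mul_comm, hDS]
  have := hπ.gaussian
  have : IsGaussian (π.map Prod.snd) :=
    isGaussian_map (ContinuousLinearMap.snd ℝ (Fin n → ℝ) (Fin n → ℝ))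
  obtain ⟨c, V, hV, hcV⟩ := exists_integral_cexp_of_isGaussian (ν := π.map Prod.snd)
  obtain ⟨φ, hφ⟩ := exists_tendsto_logDet M.B (H * M.C) hA hW hV
  have htr := tendsto_trace_responseCov M.B (H * M.C) hA hS V
  rw [hDS] at htr
  have hle := le_of_tendsto_of_tendsto' hφ htr fun T =>
    div_le_div_of_nonneg_right (logDet_le_trace (M.loopMatrix L) M.B (H * M.C) hW hV T)
      (Nat.cast_nonneg T)
  set τ := (M.innovCov⁻¹ * M.C * S * M.Cᵀ).trace
  -- One `τ` comes from the covariance produced by the recorded watermarks, the other from the mean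
  -- produced by the current one. The limit does not depend on the realization.
  refine ⟨(τ - φ + τ) / 2, by linarith, ?_⟩
  have hae := ae_tendsto_average_quadratic (η := gaussianVec 0 W)
    (memLp_two_eval_gaussianVec 0 W) (integral_eval_gaussianVec 0 W)
    (integral_eval_mul_eval_gaussianVec hW) hA hS (M.xhat0 - c) ((H * M.C)ᵀ * (H * M.C))
  filter_upwards [hae] with δ hδ
  rw [hDS'] at hδ
  -- Shift by one: the horizon `T` comprises the `T + 1` outputs `y_0, …, y_T`.
  have hlim := ((((htr.sub hφ).add hδ).div_const 2).comp (tendsto_add_atTop_nat 1))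
  refine ((ENNReal.continuous_ofReal.tendsto _).comp hlim).congr fun T => ?_
  rw [infoFlow, M.klDiv_outputLaw_replayAttack δ hP hM hW hπ hH' hV hcV,
    show (T : ℝ≥0∞) + 1 = ENNReal.ofReal ((T + 1 : ℕ) : ℝ) by
      rw [ENNReal.ofReal_natCast]; push_cast; rfl,
    ← ENNReal.ofReal_div_of_pos (by positivity)]
  simp only [Function.comp_apply]
  congr 1
  ring

end Model

end ReplayAttack

theorem mainTheorem4 {n p m : ℕ} (M : ReplayAttack.Model n p m) (L : Matrix (Fin p) (Fin n) ℝ)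
    (W : Matrix (Fin p) (Fin p) ℝ) (hW : W.PosSemidef)
    (hP : M.innovCov.PosDef) (hM : M.FilterSteady)
    (π : Measure ((Fin n → ℝ) × (Fin n → ℝ))) (hπ : M.IsSteadyState L W π)
    (hρ : spectralRadius ℂ ((M.loopMatrix L).map Complex.ofReal) < 1)
    {Ω : Type*} [MeasurableSpace Ω] (μ : Measure Ω) [IsProbabilityMeasure μ]
    (Δu : ℕ → Ω → Fin p → ℝ) (hΔu_indep : iIndepFun Δu μ)
    (hΔu_law : ∀ k, HasLaw (Δu k) (ReplayAttack.gaussianVec 0 W) μ) :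
    (∃! S : Matrix (Fin n) (Fin n) ℝ,
      S = M.loopMatrix L * S * (M.loopMatrix L)ᵀ + M.B * W * M.Bᵀ) ∧
    ∀ S : Matrix (Fin n) (Fin n) ℝ,
      S = M.loopMatrix L * S * (M.loopMatrix L)ᵀ + M.B * W * M.Bᵀ →
      ∀ᵐ ω ∂μ,
        (∃ ℓ : ℝ, (M.innovCov⁻¹ * M.C * S * M.Cᵀ).trace / 2 ≤ ℓ ∧
          Tendsto
            (fun T => M.infoFlow L W π (fun k => Δu k ω) (ReplayAttack.replayAttack m) T) atTop
            (𝓝 (ENNReal.ofReal ℓ))) ∧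
        ∀ ε : ℝ, ε < (M.innovCov⁻¹ * M.C * S * M.Cᵀ).trace / 2 →
          ∀ᶠ T in atTop,
            M.StrongInfoFlow L W π (fun k => Δu k ω) {ReplayAttack.replayAttack m} ε T := by
  have hA := ReplayAttack.tendsto_pow_of_spectralRadius_map_lt_one hρ
  refine ⟨ReplayAttack.existsUnique_lyapunov hA _, fun S hS => ?_⟩
  obtain ⟨ℓ, hℓ, hae⟩ := M.ae_tendsto_infoFlow_replayAttack hW hP hM hπ hA hS
  -- The watermark sequence on `Ω` has the infinite product law, so the almost sure statement pulls
  -- back to `μ`.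
  have hlaw := hΔu_indep.hasLaw_infinitePi hΔu_law
    (aemeasurable_pi_lambda _ fun k => (hΔu_law k).aemeasurable)
  rw [← hlaw.map_eq] at hae
  filter_upwards [ae_of_ae_map hlaw.aemeasurable hae] with ω hω
  refine ⟨⟨ℓ, hℓ, hω⟩, fun ε hε => ?_⟩
  have hev : ∀ᶠ T in atTop, ENNReal.ofReal ε ≤
      M.infoFlow L W π (fun k => Δu k ω) (ReplayAttack.replayAttack m) T := by
    -- For `ε ≤ 0` the bound `ENNReal.ofReal ε` is zero. Otherwise `ε < ℓ` strictly, and convergence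
    -- gives the bound eventually.
    rcases le_or_gt ε 0 with h0 | h0
    · simp [ENNReal.ofReal_of_nonpos h0]
    · exact (hω.eventually (lt_mem_nhds ((ENNReal.ofReal_lt_ofReal_iff_of_nonneg h0.le).2
        (hε.trans_le hℓ)))).mono fun T hT => hT.le
  filter_upwards [hev] with T hT a ha
  rwa [Set.mem_singleton_iff.1 ha]
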